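/- Let $\mu,d\in\mathbb C$ and $\nu>0$. Let $y(x)$ be a branch, meromorphic on $0<|x|<\rho$, $|\arg x|<\pi$, of a solution of $$y''=\tfrac12\Big[\tfrac1y+\tfrac1{y-1}+\tfrac1{y-x}\Big](y')^2-\Big[\tfrac1x+\tfrac1{x-1}+\tfrac1{y-x}\Big]y'+\tfrac12\,\tfrac{y(y-1)(y-x)}{x^2(x-1)^2}\Big[(2\mu-1)^2+\tfrac{x(x-1)}{(y-x)^2}\Big]$$ with an expansion $\frac1{y(x)}=\sum_{n\ge1}x^{n-1}y_n(x)$, $y_n(x)=\sum_{m=-n}^{n}A_{nm}e^{2imd}x^{2im\nu}$, converging absolutely as a double series for $0<|x|<\rho$, $|\arg x|<\pi$, with leading term $$y_1(x)=\frac{(2\mu-1+2i\nu)^2e^{-2id}x^{-2i\nu}}{16\nu^2}-\frac{(2\mu-1)^2-4\nu^2}{8\nu^2}+\frac{(2\mu-1-2i\nu)^2e^{2id}x^{2i\nu}}{16\nu^2}.$$ Write $1/y(x)=y_1(x)+xf(x)$. On the universal covering of $\mathbb C\setminus\{0\}$, the zeros of $y_1$ lie on at most two rays $\arg x=\theta_j$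 ($\theta_j\in\mathbb R$, not reduced mod $2\pi$). For $R,\varepsilon>0$ let $${\cal U}(R,\varepsilon)=\{x:\ 0<|x|\le R,\ |\arg x|<\pi,\ |\arg x-\theta_j|\ge\varepsilon\ \text{for all } j\},$$ the disk of radius $R$ minus the sectors of half-angle $\varepsilon$ bisected by these rays. Then: (i) $f$ is bounded on $0<|x|\le r$, $|\arg x|<\pi$, for every $r<\rho$, and for every $\varepsilon>0$ there is $R_\varepsilon\in(0,\rho)$ such that $y$ has no poles in ${\cal U}(R_\varepsilon,\varepsilon)$. (ii) If $\mu\ne\frac12$, there is a function $g(\varepsilon)=O(\tan^2\varepsilon)$, $\varepsilon\to0^+$, depending only on $\mu,\nu,d$, such that the following holds. Let $0<r<\rho$ and $C_f>0$ be such that $|f(x)|\le C_f$ for $0<|x|\le r$, $|\arg x|<\pi$. Then for all sufficiently small $\varepsilon>0$, every $R_\varepsilon$ with $$0<R_\varepsilon<\frac{|2\mu-1|}{C_f}\tan\varepsilon\,(1+g(\varepsilon))$$ satisfies $R_\varepsilon<\rho$, and $y$ has no poles in ${\cal U}(R_\varepsilon,\varepsilon)$. (iii) If $\mu=\frac12$,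 the same holds with $g(\varepsilon)=O(\tan^3\varepsilon)$ and the condition $$0<R_\varepsilon<\frac{2\nu^2}{C_f}\tan^2\varepsilon\,(1+g(\varepsilon)).$$ -/

import Mathlib

open Complex Filter Topology Asymptotics

/-- The differential equation `PVI_μ` for the function `y` at the point `x`
(meaningful where `x ≠ 0, 1` and `y x ≠ 0, 1, x`). -/
def SolvesPVIAt (μ : ℂ) (y : ℂ → ℂ) (x : ℂ) : Prop :=
  deriv (deriv y) x =
    1 / 2 * (1 / y x + 1 / (y x - 1) + 1 / (y x - x)) * (deriv y x) ^ 2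
      - (1 / x + 1 / (x - 1) + 1 / (y x - x)) * deriv y x
      + 1 / 2 * (y x * (y x - 1) * (y x - x) / (x ^ 2 * (x - 1) ^ 2))
          * ((2 * μ - 1) ^ 2 + x * (x - 1) / (y x - x) ^ 2)

/-- The punctured disk `0 < |x| < ρ` with the branch cut: `|arg x| < π`. -/
def cutDisk (ρ : ℝ) : Set ℂ := {x | x ∈ slitPlane ∧ ‖x‖ < ρ}

/-- The monomial `A_{nm} e^{2 i m d} x^{2 i m ν}`, written in the coordinate `s = log x` of the
universal covering of the punctured plane. -/
noncomputable def mode (A : ℕ → ℤ → ℂ) (ν : ℝ) (d : ℂ) (n : ℕ) (m : ℤ) (s : ℂ) : ℂ :=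
  A n m * exp (2 * I * m * d) * exp (2 * I * m * ν * s)

/-- `y_n` as a function of `s = log x`, on the whole universal covering. -/
noncomputable def yLift (A : ℕ → ℤ → ℂ) (ν : ℝ) (d : ℂ) (n : ℕ) (s : ℂ) : ℂ :=
  ∑ m ∈ Finset.Icc (-(n : ℤ)) n, mode A ν d n m s

/-- `y_n(x) = ∑_{m=-n}^{n} A_{nm} e^{2imd} x^{2imν}`, on the branch `|arg x| < π`. -/
noncomputable def yTerm (A : ℕ → ℤ → ℂ) (ν : ℝ) (d : ℂ) (n : ℕ) (x : ℂ) : ℂ :=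
  yLift A ν d n (log x)

/-- `y` is a branch, on `0 < |x| < ρ`, `|arg x| < π`, of a solution of `PVI_μ`, with the expansion
`1 / y(x) = ∑_{n ≥ 1} x^{n-1} y_n(x)` whose leading term is
`y_1(x) = (2μ-1+2iν)² e^{-2id} x^{-2iν} / (16ν²) - ((2μ-1)²-4ν²) / (8ν²)
  + (2μ-1-2iν)² e^{2id} x^{2iν} / (16ν²)`. -/
structure IsBranch (μ : ℂ) (ν : ℝ) (d : ℂ) (ρ : ℝ) (A : ℕ → ℤ → ℂ) (y : ℂ → ℂ) : Prop where
  radius_pos : 0 < ρ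
  coeff_neg_one : A 1 (-1) = (2 * μ - 1 + 2 * I * ν) ^ 2 / (16 * ν ^ 2)
  coeff_zero : A 1 0 = -(((2 * μ - 1) ^ 2 - 4 * ν ^ 2) / (8 * ν ^ 2))
  coeff_one : A 1 1 = (2 * μ - 1 - 2 * I * ν) ^ 2 / (16 * ν ^ 2)
  /-- the series converges as a (Laurent) series in the two variables `x` and `x^{2iν}` -/
  summable : ∀ x ∈ cutDisk ρ, Summable fun n : ℕ =>
    ‖x‖ ^ n * ∑ m ∈ Finset.Icc (-((n + 1 : ℕ) : ℤ)) (n + 1 : ℕ), ‖mode A ν d (n + 1) m (log x)‖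
  meromorphic : MeromorphicOn y (cutDisk ρ)
  /-- the expansion, at all regular points of `y` -/
  expansion : ∀ x ∈ cutDisk ρ, AnalyticAt ℂ y x →
    y x ≠ 0 ∧ HasSum (fun n : ℕ => x ^ n * yTerm A ν d (n + 1) x) (1 / y x)
  solves : ∀ x ∈ cutDisk ρ, AnalyticAt ℂ y x →
    x ≠ 1 → y x ≠ 0 → y x ≠ 1 → y x ≠ x → SolvesPVIAt μ y x

/-- The remainder `f(x) = ∑_{n ≥ 2} x^{n-2} y_n(x)`, so that `1 / y(x) = y_1(x) + x f(x)`. -/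
noncomputable def remainder (A : ℕ → ℤ → ℂ) (ν : ℝ) (d : ℂ) (x : ℂ) : ℂ :=
  ∑' n : ℕ, x ^ n * yTerm A ν d (n + 2) x

/-- `|f(x)| ≤ C` on the disk of radius `r`. -/
def RemainderBound (A : ℕ → ℤ → ℂ) (ν : ℝ) (d : ℂ) (r C : ℝ) : Prop :=
  ∀ x ∈ slitPlane, ‖x‖ ≤ r → ‖remainder A ν d x‖ ≤ C

/-- The angles of the axes on which the zeros of `y_1` lie. The zeros `x = e^s` are taken on the
universal covering, so that the angle `Im s = arg x` is a real number, not reduced mod `2π`. -/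
def axisAngles (A : ℕ → ℤ → ℂ) (ν : ℝ) (d : ℂ) : Set ℝ :=
  {θ | ∃ s : ℂ, yLift A ν d 1 s = 0 ∧ s.im = θ}

/-- `U(R, ε)`: the disk of radius `R`, on the branch `|arg x| < π`, minus the open sectors of
amplitude `2ε` bisected by the axes of the zeros of `y_1`. -/
def sectorRegion (A : ℕ → ℤ → ℂ) (ν : ℝ) (d : ℂ) (R ε : ℝ) : Set ℂ :=
  {x | x ∈ slitPlane ∧ ‖x‖ ≤ R ∧ ∀ θ ∈ axisAngles A ν d, ε ≤ |arg x - θ|}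

/-- `y` has no pole in `S`. -/
def NoPolesOn (y : ℂ → ℂ) (S : Set ℂ) : Prop :=
  ∀ x ∈ S, ¬ meromorphicOrderAt y x < 0

/-! Put `s = log x`, `a = 2μ - 1`, and let `U = y₁ + x y₂ + x² (…)` be the sum of the series. It is
analytic on the logarithmic strip, so a pole of `y` is a zero of `U`
(`tailLift_log_eq_zero_of_pole`). Hence `y₁ = O(x)` at a pole. By periodicity of `y₁` and
compactness, `log x` is then close to a zero `s₀` of `y₁` (`exists_zero_near`), which already gives
(i).

The quantitative parts need `y₂` near `s₀`. Substituting `U` into the equation and comparing terms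
of first order in `x` gives a linear equation for `y₂` (`linOp_yLift_eq`). Here the coefficients of
`x` can be separated because translation of `s` by multiples of `π/ν` fixes every `y_n` and sends
`x` to `0`. The linear operator is injective on Laurent polynomials with the relevant modes, so `y₂
= (y₁(1 - y₁) + y₁')/2` (`yLift_two_explicit`). At a zero of `y₁` one has `y₁' = ±a` and `y₂ =
y₁'/2`.

If `a ≠ 0`, then `log x - s₀ = -x/2 + O(x²)`: the angular deviation is at most `|Im x|/2 + O(|x|²)`.
For `|x| < (|a|/C) tan ε` it is below `ε` as soon as `|a|/2 < C`. When `s₀` is inside the strip this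
follows from the maximum principle, since `|y₂| ≤ C` and `|y₂(s₀)| = |a|/2`
(`half_norm_lt_of_zero`). When `s₀` is not inside, `x` is nearly real and `|Im x|` is itself of
second order.

If `a = 0`, the zeros are double, `y₁ ≈ ν² (s - s₀)²`, and `y₂` vanishes at `s₀`. So `log x - s₀ =
O(x) = O(tan² ε)`, far below `ε`. In both cases `g = 0` suffices. -/

/-! ### Polynomial form of the equation and its linearisation at `x = 0`. -/

/-- The polynomial form of `PVI_μ` (`a = 2μ - 1`) in terms of `u = 1 / y` and its first two
derivatives `u₁`, `u₂` with respect to `log x`. -/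
def pviPoly (a x u u₁ u₂ : ℂ) : ℂ :=
  2 * u * (1 - u) * (1 - x * u) * (1 - x) ^ 2 * u₂
    - (1 - x) ^ 2 * u₁ ^ 2 * ((1 - 2 * u) + x * (3 * u ^ 2 - 2 * u))
    - 2 * x * (1 - x) * u * (1 - u) * (1 - x * u) * u₁
    + 2 * x * u ^ 2 * (1 - u) * (1 - x) ^ 2 * u₁
    + (1 - u) ^ 2 * (a ^ 2 * (1 - x * u) ^ 2 - x * (1 - x) * u ^ 2)

/-- The hypotheses on `y₁`, `y₂` are the chain rule for `y = 1/u` with `d/dx = x⁻¹ d/ds`; what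
remains is clearing denominators. -/
theorem pviPoly_eq_zero_of_pvi {a x u u₁ u₂ y y₁ y₂ : ℂ} (hx : x ≠ 0) (hx1 : x ≠ 1) (hu : u ≠ 0)
    (hu1 : u ≠ 1) (hxu : x * u ≠ 1) (hy : y = 1 / u) (hy₁ : y₁ = -(u₁ / x) / u ^ 2)
    (hy₂ : y₂ = -((u₂ - u₁) / x ^ 2) / u ^ 2 + 2 * (u₁ / x) ^ 2 / u ^ 3)
    (h : y₂ = 1 / 2 * (1 / y + 1 / (y - 1) + 1 / (y - x)) * y₁ ^ 2
      - (1 / x + 1 / (x - 1) + 1 / (y - x)) * y₁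
      + 1 / 2 * (y * (y - 1) * (y - x) / (x ^ 2 * (x - 1) ^ 2))
          * (a ^ 2 + x * (x - 1) / (y - x) ^ 2)) :
    pviPoly a x u u₁ u₂ = 0 := by
  have e1 : (1 - u) ≠ 0 := sub_ne_zero.2 hu1.symm
  have e2 : (1 - x * u) ≠ 0 := sub_ne_zero.2 hxu.symm
  have e3 : x - 1 ≠ 0 := sub_ne_zero.2 hx1
  have f1 : y - 1 = (1 - u) / u := by rw [hy]; field_simp
  have f2 : y - x = (1 - x * u) / u := by rw [hy]; field_simp
  rw [f1, f2, hy₁, hy₂, hy] at h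
  have key : pviPoly a x u u₁ u₂ = -(2 * u ^ 3 * (1 - u) * (1 - x * u) * (x - 1) ^ 2 * x ^ 2) *
    (-((u₂ - u₁) / x ^ 2) / u ^ 2 + 2 * (u₁ / x) ^ 2 / u ^ 3 -
     (1 / 2 * (1 / (1 / u) + 1 / ((1 - u) / u) + 1 / ((1 - x * u) / u)) * (-(u₁ / x) / u ^ 2) ^ 2
      - (1 / x + 1 / (x - 1) + 1 / ((1 - x * u) / u)) * (-(u₁ / x) / u ^ 2)
      + 1 / 2 * (1 / u * ((1 - u) / u) * ((1 - x * u) / u) / (x ^ 2 * (x - 1) ^ 2))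
          * (a ^ 2 + x * (x - 1) / ((1 - x * u) / u) ^ 2))) := by
    unfold pviPoly
    obtain ⟨w, hw⟩ : ∃ w, w = 1 - x * u := ⟨_, rfl⟩
    rw [← hw] at e2 ⊢
    field_simp
    rw [hw]
    ring
  rw [key, sub_eq_zero.2 h, mul_zero]

/-- The linear part of the first-order variation of `pviPoly` in `x` at `x = 0`. -/
def linOp (a p p₁ p₂ v v₁ v₂ : ℂ) : ℂ :=
  2 * p * (1 - p) * v₂ + 2 * (1 - 2 * p) * p₂ * v - 2 * (1 - 2 * p) * p₁ * v₁ + 2 * p₁ ^ 2 * v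
    - 2 * a ^ 2 * (1 - p) * v

theorem linOp_mul (a p p₁ p₂ v v₁ v₂ c : ℂ) :
    linOp a p p₁ p₂ (c * v) (c * v₁) (c * v₂) = c * linOp a p p₁ p₂ v v₁ v₂ := by
  unfold linOp; ring

/-- Indicial argument. With `t = e^{-ls}`, the term `x e^{(m-j)ls}` has logarithmic derivative `1 +
(m - j) l`. After multiplication by `t²` the equation is polynomial in `t`, and its value at `t = 0`
isolates `k₀`. -/
theorem coeff_eq_zero_of_linOp {a α β c l m k₀ k₁ k₂ k₃ k₄ : ℂ} (hα : α ≠ 0)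
    (hl : 1 + (m - 1) * l ≠ 0)
    (H : ∀ t : ℂ, t ≠ 0 → linOp a (α * t⁻¹ + c + β * t) (l * (α * t⁻¹ - β * t))
      (l ^ 2 * (α * t⁻¹ + β * t))
      (k₀ + k₁ * t + k₂ * t ^ 2 + k₃ * t ^ 3 + k₄ * t ^ 4)
      ((1 + m * l) * k₀ + (1 + (m - 1) * l) * k₁ * t + (1 + (m - 2) * l) * k₂ * t ^ 2
        + (1 + (m - 3) * l) * k₃ * t ^ 3 + (1 + (m - 4) * l) * k₄ * t ^ 4)
      ((1 + m * l) ^ 2 * k₀ + (1 + (m - 1) * l) ^ 2 * k₁ * t + (1 + (m - 2) * l) ^ 2 * k₂ * t ^ 2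
        + (1 + (m - 3) * l) ^ 2 * k₃ * t ^ 3 + (1 + (m - 4) * l) ^ 2 * k₄ * t ^ 4) = 0) :
    k₀ = 0 := by
  set g : ℂ → ℂ := fun t => k₀ + k₁ * t + k₂ * t ^ 2 + k₃ * t ^ 3 + k₄ * t ^ 4 with hg
  set g1 : ℂ → ℂ := fun t => (1 + m * l) * k₀ + (1 + (m - 1) * l) * k₁ * t
    + (1 + (m - 2) * l) * k₂ * t ^ 2
    + (1 + (m - 3) * l) * k₃ * t ^ 3 + (1 + (m - 4) * l) * k₄ * t ^ 4 with hg1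
  set g2 : ℂ → ℂ := fun t => (1 + m * l) ^ 2 * k₀ + (1 + (m - 1) * l) ^ 2 * k₁ * t
    + (1 + (m - 2) * l) ^ 2 * k₂ * t ^ 2
    + (1 + (m - 3) * l) ^ 2 * k₃ * t ^ 3 + (1 + (m - 4) * l) ^ 2 * k₄ * t ^ 4 with hg2
  set R : ℂ → ℂ := fun t =>
    2 * (α + c * t + β * t ^ 2) * (t - (α + c * t + β * t ^ 2)) * g2 t
    + 2 * (t - 2 * (α + c * t + β * t ^ 2)) * (l ^ 2 * (α + β * t ^ 2)) * g t
    - 2 * (t - 2 * (α + c * t + β * t ^ 2)) * (l * (α - β * t ^ 2)) * g1 t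
    + 2 * (l * (α - β * t ^ 2)) ^ 2 * g t
    - 2 * a ^ 2 * (t - (α + c * t + β * t ^ 2)) * t * g t with hR
  have hcont : Continuous R := by simp only [hR, hg, hg1, hg2]; fun_prop
  have h0 : ∀ t ∈ ({0}ᶜ : Set ℂ), R t = 0 := by
    intro t ht
    have ht : t ≠ 0 := ht
    have := H t ht
    have e : R t = t ^ 2 * linOp a (α * t⁻¹ + c + β * t) (l * (α * t⁻¹ - β * t))
      (l ^ 2 * (α * t⁻¹ + β * t)) (g t) (g1 t) (g2 t) := by
      simp only [hR, linOp]
      field_simp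
    rw [e]
    simp only [hg, hg1, hg2]
    rw [this, mul_zero]
  have hz : R 0 = 0 := by
    have hd : Dense ({0}ᶜ : Set ℂ) := dense_compl_singleton 0
    have : R = fun _ => 0 := Continuous.ext_on hd hcont continuous_const h0
    rw [this]
  -- The indicial polynomial `(1 + ml)² - 2l(1 + ml) + l²` is a perfect square.
  have : R 0 = -2 * α ^ 2 * (1 + (m - 1) * l) ^ 2 * k₀ := by
    simp only [hR, hg, hg1, hg2]; ring
  rw [this] at hz
  simpa [hα, hl] using hz

/-- The modes are peeled off from the top: once the coefficient of mode `m` vanishes, a power of `t`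
makes mode `m - 1` the leading one. -/
theorem eq_zero_of_linOp_aux {a α β c l h₂ h₁ h₀ g₁ g₂ : ℂ} (hα : α ≠ 0)
    (hl : ∀ m : ℤ, 1 + (m : ℂ) * l ≠ 0)
    (H : ∀ t : ℂ, t ≠ 0 → linOp a (α * t⁻¹ + c + β * t) (l * (α * t⁻¹ - β * t))
      (l ^ 2 * (α * t⁻¹ + β * t))
      (h₂ * t⁻¹ ^ 2 + h₁ * t⁻¹ + h₀ + g₁ * t + g₂ * t ^ 2)
      ((1 + 2 * l) * h₂ * t⁻¹ ^ 2 + (1 + l) * h₁ * t⁻¹ + h₀ + (1 - l) * g₁ * t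
        + (1 - 2 * l) * g₂ * t ^ 2)
      ((1 + 2 * l) ^ 2 * h₂ * t⁻¹ ^ 2 + (1 + l) ^ 2 * h₁ * t⁻¹ + h₀ + (1 - l) ^ 2 * g₁ * t
        + (1 - 2 * l) ^ 2 * g₂ * t ^ 2) = 0) :
    h₂ = 0 ∧ h₁ = 0 ∧ h₀ = 0 ∧ g₁ = 0 ∧ g₂ = 0 := by
  have e2 : h₂ = 0 := by
    refine coeff_eq_zero_of_linOp (a := a) (β := β) (c := c) (l := l) (m := 2) (k₁ := h₁)
      (k₂ := h₀) (k₃ := g₁) (k₄ := g₂) hα (by have := hl 1; convert this using 2; push_cast; ring) ?_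
    intro t ht
    have := H t ht
    refine Eq.trans ?_ ((linOp_mul _ _ _ _ _ _ _ (t ^ 2)).trans (by rw [this, mul_zero]))
    congr 1 <;> field_simp <;> ring_nf
  subst e2
  have e1 : h₁ = 0 := by
    refine coeff_eq_zero_of_linOp (a := a) (β := β) (c := c) (l := l) (m := 1) (k₁ := h₀)
      (k₂ := g₁) (k₃ := g₂) (k₄ := 0) hα (by have := hl 0; convert this using 2; push_cast; ring) ?_
    intro t ht
    have := H t ht
    refine Eq.trans ?_ ((linOp_mul _ _ _ _ _ _ _ t).trans (by rw [this, mul_zero]))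
    congr 1 <;> field_simp <;> ring_nf
  subst e1
  have e0 : h₀ = 0 := by
    refine coeff_eq_zero_of_linOp (a := a) (β := β) (c := c) (l := l) (m := 0) (k₁ := g₁)
      (k₂ := g₂) (k₃ := 0) (k₄ := 0) hα (by have := hl (-1); convert this using 2; push_cast; ring) ?_
    intro t ht
    have := H t ht
    refine Eq.trans ?_ this
    congr 1 <;> field_simp <;> ring_nf
  subst e0
  have d1 : g₁ = 0 := by
    refine coeff_eq_zero_of_linOp (a := a) (β := β) (c := c) (l := l) (m := -1) (k₁ := g₂)
      (k₂ := 0) (k₃ := 0) (k₄ := 0) hα (by have := hl (-2); convert this using 2; push_cast; ring) ?_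
    intro t ht
    have := H t ht
    refine Eq.trans ?_ ((linOp_mul _ _ _ _ _ _ _ t⁻¹).trans (by rw [this, mul_zero]))
    congr 1 <;> field_simp <;> ring_nf
  subst d1
  have d2 : g₂ = 0 := by
    refine coeff_eq_zero_of_linOp (a := a) (β := β) (c := c) (l := l) (m := -2) (k₁ := 0)
      (k₂ := 0) (k₃ := 0) (k₄ := 0) hα (by have := hl (-3); convert this using 2; push_cast; ring) ?_
    intro t ht
    have := H t ht
    refine Eq.trans ?_ ((linOp_mul _ _ _ _ _ _ _ (t⁻¹ ^ 2)).trans (by rw [this, mul_zero]))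
    congr 1 <;> field_simp <;> ring_nf
  exact ⟨rfl, rfl, rfl, rfl, d2⟩

/-- The kernel of `linOp` on Laurent polynomials with modes `-2, …, 2` is trivial. -/
theorem eq_zero_of_linOp {a α β c l h₂ h₁ h₀ g₁ g₂ : ℂ} (hαβ : α ≠ 0 ∨ β ≠ 0)
    (hl : ∀ m : ℤ, 1 + (m : ℂ) * l ≠ 0)
    (H : ∀ t : ℂ, t ≠ 0 → linOp a (α * t⁻¹ + c + β * t) (l * (α * t⁻¹ - β * t))
      (l ^ 2 * (α * t⁻¹ + β * t))
      (h₂ * t⁻¹ ^ 2 + h₁ * t⁻¹ + h₀ + g₁ * t + g₂ * t ^ 2)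
      ((1 + 2 * l) * h₂ * t⁻¹ ^ 2 + (1 + l) * h₁ * t⁻¹ + h₀ + (1 - l) * g₁ * t
        + (1 - 2 * l) * g₂ * t ^ 2)
      ((1 + 2 * l) ^ 2 * h₂ * t⁻¹ ^ 2 + (1 + l) ^ 2 * h₁ * t⁻¹ + h₀ + (1 - l) ^ 2 * g₁ * t
        + (1 - 2 * l) ^ 2 * g₂ * t ^ 2) = 0) :
    h₂ = 0 ∧ h₁ = 0 ∧ h₀ = 0 ∧ g₁ = 0 ∧ g₂ = 0 := by
  rcases hαβ with hα | hβ
  · exact eq_zero_of_linOp_aux hα hl H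
  -- The substitution `t ↦ t⁻¹`, `l ↦ -l` exchanges `α` and `β`.
  · have := eq_zero_of_linOp_aux (a := a) (α := β) (β := α) (c := c) (l := -l) (h₂ := g₂)
      (h₁ := g₁) (h₀ := h₀) (g₁ := h₁) (g₂ := h₂) hβ
      (fun m => by have := hl (-m); convert this using 2; push_cast; ring) (by
        intro t ht
        have := H t⁻¹ (inv_ne_zero ht)
        refine Eq.trans ?_ this
        rw [inv_inv]
        congr 1 <;> ring)
    tauto

theorem linOp_sub (a p p₁ p₂ v v₁ v₂ w w₁ w₂ : ℂ) :
    linOp a p p₁ p₂ (v - w) (v₁ - w₁) (v₂ - w₂)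
      = linOp a p p₁ p₂ v v₁ v₂ - linOp a p p₁ p₂ w w₁ w₂ := by
  unfold linOp; ring

/-- The inhomogeneity of the first-order variation of `pviPoly`. -/
def linRhs (a p p₁ p₂ : ℂ) : ℂ :=
  2 * p * (1 - p) * (p + 2) * p₂ + p₁ ^ 2 * (3 * p ^ 2 + 2 * p - 2) + 2 * p * (1 - p) ^ 2 * p₁
    + (1 - p) ^ 2 * (2 * a ^ 2 * p + p ^ 2)

/-- The candidate is `v = (p(1 - p) + p')/2`. The three arguments are `v`, `v + v'`, `v + 2v' +
v''`, that is, the derivatives of `x v` in `log x` divided by `x`, with `p''' = l² p'`. -/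
theorem linOp_particular {a l p p₁ p₂ : ℂ} (h1 : p₁ ^ 2 = (1 - p) * (a ^ 2 - l ^ 2 * p))
    (h2 : p₂ = -(a ^ 2 + l ^ 2) / 2 + l ^ 2 * p) :
    linOp a p p₁ p₂ ((p * (1 - p) + p₁) / 2)
      ((p * (1 - p) + p₁) / 2 + ((1 - 2 * p) * p₁ + p₂) / 2)
      ((p * (1 - p) + p₁) / 2 + 2 * (((1 - 2 * p) * p₁ + p₂) / 2)
        + ((1 - 2 * p) * p₂ - 2 * p₁ ^ 2 + l ^ 2 * p₁) / 2) = linRhs a p p₁ p₂ := by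
  have h3 : p₁ ^ 3 = p₁ * ((1 - p) * (a ^ 2 - l ^ 2 * p)) := by rw [← h1]; ring
  unfold linOp linRhs
  rw [h2]
  ring_nf
  simp only [h3, h1]
  ring

/-! ### Convergence of the series, uniform up to the edges of the strip. -/

/-- A majorant of `yLift A ν d n` on the strip `|Im s| ≤ π`. -/
noncomputable def modeBound (A : ℕ → ℤ → ℂ) (ν : ℝ) (d : ℂ) (n : ℕ) : ℝ :=
  ∑ m ∈ Finset.Icc (-(n : ℤ)) n, ‖A n m * exp (2 * I * m * d)‖ * Real.exp (2 * ν * |(m : ℝ)| * Real.pi)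

theorem modeBound_nonneg (A : ℕ → ℤ → ℂ) (ν : ℝ) (d : ℂ) (n : ℕ) : 0 ≤ modeBound A ν d n :=
  Finset.sum_nonneg fun _ _ => by positivity

theorem norm_mode (A : ℕ → ℤ → ℂ) (ν : ℝ) (d : ℂ) (n : ℕ) (m : ℤ) (s : ℂ) :
    ‖mode A ν d n m s‖ = ‖A n m * exp (2 * I * m * d)‖ * Real.exp (-(2 * ν * m * s.im)) := by
  rw [mode, norm_mul, norm_exp (2 * I * m * ν * s)]
  congr 2
  have : 2 * I * m * ν * s = ((2 * ν * m : ℝ) : ℂ) * (I * s) := by push_cast; ring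
  rw [this, re_ofReal_mul]
  simp

theorem norm_yLift_le {A : ℕ → ℤ → ℂ} {ν : ℝ} (hν : 0 < ν) (d : ℂ) (n : ℕ) {s : ℂ}
    (hs : |s.im| ≤ Real.pi) : ‖yLift A ν d n s‖ ≤ modeBound A ν d n := by
  refine (norm_sum_le _ _).trans (Finset.sum_le_sum fun m _ => ?_)
  rw [norm_mode]
  gcongr
  have h1 : -((m : ℝ) * s.im) ≤ |(m : ℝ)| * Real.pi := by
    refine (neg_le_abs _).trans ?_
    rw [abs_mul]
    gcongr
  nlinarith

theorem exists_angle_mul_exp_le {ν r r' : ℝ} (hrr : r < r') :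
    ∃ θ : ℝ, 0 < θ ∧ θ < Real.pi ∧ r * Real.exp (2 * ν * (Real.pi - θ)) ≤ r' := by
  have hc : Tendsto (fun θ : ℝ => r * Real.exp (2 * ν * (Real.pi - θ))) (𝓝[<] Real.pi) (𝓝 r) := by
    have : Continuous fun θ : ℝ => r * Real.exp (2 * ν * (Real.pi - θ)) := by fun_prop
    have h := (this.tendsto Real.pi).mono_left (nhdsWithin_le_nhds (s := Set.Iio Real.pi))
    simpa using h
  have h1 := hc.eventually (eventually_le_nhds hrr)
  have h2 : ∀ᶠ θ in 𝓝[<] Real.pi, θ ∈ Set.Ioo 0 Real.pi := Ioo_mem_nhdsLT Real.pi_pos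
  obtain ⟨θ, h1, h2⟩ := (h1.and h2).exists
  exact ⟨θ, h2.1, h2.2, h1⟩

theorem log_exp_ofReal_add {r θ : ℝ} (h1 : |θ| < Real.pi) :
    log (exp ((Real.log r : ℂ) + θ * I)) = (Real.log r : ℂ) + θ * I := by
  have := abs_lt.1 h1
  apply log_exp <;> simp <;> linarith

theorem exp_mem_cutDisk {ρ : ℝ} {s : ℂ} (h : Real.exp s.re < ρ) (h1 : |s.im| < Real.pi) :
    exp s ∈ cutDisk ρ := by
  have := abs_lt.1 h1
  refine ⟨?_, by rwa [norm_exp]⟩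
  rw [mem_slitPlane_iff_arg]
  refine ⟨?_, exp_ne_zero _⟩
  rw [← log_im, log_exp this.1 this.2.le]
  exact this.2.ne

theorem log_exp_of_abs_lt {s : ℂ} (h1 : |s.im| < Real.pi) : log (exp s) = s :=
  log_exp (abs_lt.1 h1).1 (abs_lt.1 h1).2.le

theorem abs_arg_lt_pi {x : ℂ} (hx : x ∈ slitPlane) : |arg x| < Real.pi :=
  lt_of_le_of_ne (abs_arg_le_pi x) fun h => by
    rcases (abs_eq Real.pi_pos.le).1 h with h | h
    · exact slitPlane_arg_ne_pi hx h
    · exact (neg_pi_lt_arg x).ne' h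

/-- Convergence is assumed only for `|arg x| < π`, but the majorant is taken at `|arg x| = π`.
Replacing `π` by a nearby `θ` costs a factor `e^{2ν(π-θ)}` per unit of `|m| ≤ n + 1`, which is
absorbed by enlarging `r` to `r' < ρ`. The two rays `±θ` handle the two signs of `m`. -/
theorem summable_modeBound {μ d : ℂ} {ν ρ : ℝ} {A : ℕ → ℤ → ℂ} {y : ℂ → ℂ} (hν : 0 < ν)
    (hy : IsBranch μ ν d ρ A y) {r : ℝ} (hr : 0 < r) (hrρ : r < ρ) :
    Summable fun n : ℕ => r ^ n * modeBound A ν d (n + 1) := by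
  obtain ⟨r', hrr', hr'ρ⟩ := exists_between hrρ
  have hr' : 0 < r' := hr.trans hrr'
  obtain ⟨θ, hθ0, hθπ, hθ⟩ := exists_angle_mul_exp_le (ν := ν) hrr'
  have key : ∀ σ : ℝ, |σ| < Real.pi → Summable fun n : ℕ =>
      r' ^ n * ∑ m ∈ Finset.Icc (-((n + 1 : ℕ) : ℤ)) (n + 1 : ℕ),
        ‖A (n + 1) m * exp (2 * I * m * d)‖ * Real.exp (-(2 * ν * m * σ)) := by
    intro σ hσ
    have hre : ((Real.log r' : ℂ) + σ * I).re = Real.log r' := by simp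
    have him : ((Real.log r' : ℂ) + σ * I).im = σ := by simp
    have := hy.summable (exp ((Real.log r' : ℂ) + σ * I))
      (exp_mem_cutDisk (by rw [hre, Real.exp_log hr']; exact hr'ρ) (by rwa [him]))
    rw [log_exp_ofReal_add hσ, norm_exp, hre, Real.exp_log hr'] at this
    simpa only [norm_mode, him] using this
  have h1 := key θ (by rwa [abs_of_pos hθ0])
  have h2 := key (-θ) (by rwa [abs_neg, abs_of_pos hθ0])
  refine Summable.of_nonneg_of_le (fun n => mul_nonneg (by positivity) (modeBound_nonneg _ _ _ _))
    (fun n => ?_) ((h1.add h2).mul_left (Real.exp (2 * ν * (Real.pi - θ))))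
  rw [← mul_add, ← Finset.sum_add_distrib, modeBound, ← mul_assoc, Finset.mul_sum, Finset.mul_sum]
  refine Finset.sum_le_sum fun m hm => ?_
  rw [← mul_add]
  have hm' : |(m : ℝ)| ≤ n + 1 := by
    rw [Finset.mem_Icc] at hm
    rw [abs_le]
    constructor
    · have := hm.1; push_cast at this; exact_mod_cast this
    · exact_mod_cast hm.2
  have hb : Real.exp (2 * ν * |(m : ℝ)| * θ)
      ≤ Real.exp (-(2 * ν * m * θ)) + Real.exp (-(2 * ν * m * -θ)) := by
    rcases abs_cases (m : ℝ) with ⟨h, _⟩ | ⟨h, _⟩ <;> rw [h]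
    · refine le_trans (le_of_eq ?_) (le_add_of_nonneg_left (Real.exp_nonneg _)); ring_nf
    · refine le_trans (le_of_eq ?_) (le_add_of_nonneg_right (Real.exp_nonneg _)); ring_nf
  have ha : Real.exp (2 * ν * |(m : ℝ)| * Real.pi)
      ≤ Real.exp (2 * ν * (Real.pi - θ)) * Real.exp (2 * ν * (Real.pi - θ)) ^ n
        * Real.exp (2 * ν * |(m : ℝ)| * θ) := by
    rw [← Real.exp_nat_mul, ← Real.exp_add, ← Real.exp_add]
    apply Real.exp_le_exp.2
    have : 0 ≤ 2 * ν * (Real.pi - θ) := by have : 0 ≤ Real.pi - θ := by linarith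
                                           positivity
    nlinarith [mul_le_mul_of_nonneg_left hm' this]
  have hc : r ^ n * Real.exp (2 * ν * (Real.pi - θ)) ^ n ≤ r' ^ n := by
    rw [← mul_pow]; gcongr
  calc r ^ n * (‖A (n + 1) m * exp (2 * I * m * d)‖ * Real.exp (2 * ν * |(m : ℝ)| * Real.pi))
      ≤ r ^ n * (‖A (n + 1) m * exp (2 * I * m * d)‖ *
        (Real.exp (2 * ν * (Real.pi - θ)) * Real.exp (2 * ν * (Real.pi - θ)) ^ n
        * (Real.exp (-(2 * ν * m * θ)) + Real.exp (-(2 * ν * m * -θ))))) := by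
        gcongr
        exact ha.trans (by gcongr)
    _ = Real.exp (2 * ν * (Real.pi - θ)) * (r ^ n * Real.exp (2 * ν * (Real.pi - θ)) ^ n) *
        (‖A (n + 1) m * exp (2 * I * m * d)‖ *
          (Real.exp (-(2 * ν * m * θ)) + Real.exp (-(2 * ν * m * -θ)))) := by ring
    _ ≤ _ := by gcongr

theorem summable_modeBound_shift {μ d : ℂ} {ν ρ : ℝ} {A : ℕ → ℤ → ℂ} {y : ℂ → ℂ} (hν : 0 < ν)
    (hy : IsBranch μ ν d ρ A y) {r : ℝ} (hr : 0 < r) (hrρ : r < ρ) (k : ℕ) :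
    Summable fun n : ℕ => r ^ n * modeBound A ν d (n + (k + 1)) := by
  have := ((summable_nat_add_iff k).2 (summable_modeBound hν hy hr hrρ)).mul_left (r ^ k)⁻¹
  refine this.congr fun n => ?_
  rw [pow_add, add_assoc]
  field_simp

/-! ### Tails of the series as analytic functions of `log x`; poles as zeros. -/

/-- The tail `∑ x^n y_{n+k}(x)` of the expansion, as a function of `s = log x`. -/
noncomputable def tailLift (A : ℕ → ℤ → ℂ) (ν : ℝ) (d : ℂ) (k : ℕ) (s : ℂ) : ℂ :=
  ∑' n : ℕ, exp s ^ n * yLift A ν d (n + k) s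

/-- The image of the cut disk under the logarithm. -/
def logDisk (ρ : ℝ) : Set ℂ := {s | Real.exp s.re < ρ ∧ |s.im| < Real.pi}

theorem isOpen_logDisk (ρ : ℝ) : IsOpen (logDisk ρ) :=
  (isOpen_lt (Real.continuous_exp.comp continuous_re) continuous_const).inter
    (isOpen_lt continuous_im.abs continuous_const)

theorem norm_tail_term_le {A : ℕ → ℤ → ℂ} {ν : ℝ} (hν : 0 < ν) (d : ℂ) (k n : ℕ) {r : ℝ} {s : ℂ}
    (h1 : Real.exp s.re ≤ r) (h2 : |s.im| ≤ Real.pi) :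
    ‖exp s ^ n * yLift A ν d (n + k) s‖ ≤ r ^ n * modeBound A ν d (n + k) := by
  rw [norm_mul, norm_pow, norm_exp]
  have := (Real.exp_pos s.re).trans_le h1
  gcongr
  exact norm_yLift_le hν d _ h2

theorem differentiable_yLift (A : ℕ → ℤ → ℂ) (ν : ℝ) (d : ℂ) (n : ℕ) :
    Differentiable ℂ (yLift A ν d n) := by
  unfold yLift mode; fun_prop

section
variable {μ d : ℂ} {ν ρ : ℝ} {A : ℕ → ℤ → ℂ} {y : ℂ → ℂ}

theorem summable_tail (hν : 0 < ν) (hy : IsBranch μ ν d ρ A y) (k : ℕ) {s : ℂ}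
    (hs : s ∈ logDisk ρ) : Summable fun n : ℕ => exp s ^ n * yLift A ν d (n + (k + 1)) s :=
  Summable.of_norm_bounded (summable_modeBound_shift hν hy (Real.exp_pos _) hs.1 k)
    fun n => norm_tail_term_le hν d (k + 1) n le_rfl hs.2.le

theorem exists_norm_tailLift_le (hν : 0 < ν) (hy : IsBranch μ ν d ρ A y) (k : ℕ) {r : ℝ}
    (hr : 0 < r) (hrρ : r < ρ) :
    ∃ C : ℝ, 0 < C ∧ ∀ s : ℂ, Real.exp s.re ≤ r → |s.im| ≤ Real.pi →
      ‖tailLift A ν d (k + 1) s‖ ≤ C := by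
  have hsum := summable_modeBound_shift hν hy hr hrρ k
  refine ⟨∑' n : ℕ, r ^ n * modeBound A ν d (n + (k + 1)) + 1, ?_, fun s h1 h2 => ?_⟩
  · have : 0 ≤ ∑' n : ℕ, r ^ n * modeBound A ν d (n + (k + 1)) :=
      tsum_nonneg fun n => mul_nonneg (by positivity) (modeBound_nonneg _ _ _ _)
    linarith
  · refine (tsum_of_norm_bounded hsum.hasSum fun n => ?_).trans (le_add_of_nonneg_right zero_le_one)
    exact norm_tail_term_le hν d (k + 1) n h1 h2

theorem differentiableOn_tailLift (hν : 0 < ν) (hy : IsBranch μ ν d ρ A y) (k : ℕ) :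
    DifferentiableOn ℂ (tailLift A ν d (k + 1)) (logDisk ρ) := by
  intro s hs
  obtain ⟨r, h1, h2⟩ := exists_between hs.1
  have hr : 0 < r := (Real.exp_pos _).trans h1
  have hd : DifferentiableOn ℂ (tailLift A ν d (k + 1)) (logDisk r) := by
    refine differentiableOn_tsum_of_summable_norm (summable_modeBound_shift hν hy hr h2 k)
      (fun n => ?_) (isOpen_logDisk r) fun n w hw =>
        norm_tail_term_le hν d (k + 1) n hw.1.le hw.2.le
    have := differentiable_yLift A ν d (n + (k + 1))
    fun_prop
  exact (hd.differentiableAt ((isOpen_logDisk r).mem_nhds ⟨h1, hs.2⟩)).differentiableWithinAt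

theorem tailLift_eq (hν : 0 < ν) (hy : IsBranch μ ν d ρ A y) (k : ℕ) {s : ℂ}
    (hs : s ∈ logDisk ρ) :
    tailLift A ν d (k + 1) s = yLift A ν d (k + 1) s + exp s * tailLift A ν d (k + 2) s := by
  rw [tailLift, (summable_tail hν hy k hs).tsum_eq_zero_add, tailLift, ← tsum_mul_left]
  congr 1
  · simp
  · refine tsum_congr fun n => ?_
    rw [pow_succ', mul_assoc, show n + 1 + (k + 1) = n + (k + 2) by ring]

theorem log_mem_logDisk {x : ℂ} (hx : x ∈ cutDisk ρ) : log x ∈ logDisk ρ := by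
  refine ⟨?_, ?_⟩
  · rw [log_re, Real.exp_log (norm_pos_iff.2 (slitPlane_ne_zero hx.1))]
    exact hx.2
  · rw [log_im]; exact abs_arg_lt_pi hx.1

theorem remainder_eq {x : ℂ} (hx : x ∈ slitPlane) :
    remainder A ν d x = tailLift A ν d 2 (log x) := by
  simp only [remainder, tailLift, yTerm, exp_log (slitPlane_ne_zero hx)]

theorem exists_remainderBound (hν : 0 < ν) (hy : IsBranch μ ν d ρ A y) {r : ℝ} (hr : 0 < r)
    (hrρ : r < ρ) : ∃ C : ℝ, 0 < C ∧ RemainderBound A ν d r C := by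
  obtain ⟨C, hC, h⟩ := exists_norm_tailLift_le hν hy 1 hr hrρ
  refine ⟨C, hC, fun x hx hxr => ?_⟩
  rw [remainder_eq hx]
  refine h _ ?_ ?_
  · rwa [log_re, Real.exp_log (norm_pos_iff.2 (slitPlane_ne_zero hx))]
  · rw [log_im]; exact (abs_arg_lt_pi hx).le

theorem one_div_eq_tailLift {x : ℂ} (hy : IsBranch μ ν d ρ A y)
    (hx : x ∈ cutDisk ρ) (ha : AnalyticAt ℂ y x) :
    y x ≠ 0 ∧ 1 / y x = tailLift A ν d 1 (log x) := by
  obtain ⟨h0, h1⟩ := hy.expansion x hx ha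
  refine ⟨h0, h1.tsum_eq.symm.trans ?_⟩
  simp only [tailLift, yTerm, exp_log (slitPlane_ne_zero hx.1)]

theorem isOpen_cutDisk (ρ : ℝ) : IsOpen (cutDisk ρ) :=
  isOpen_slitPlane.inter (isOpen_lt continuous_norm continuous_const)

theorem eventually_one_div_eq (hy : IsBranch μ ν d ρ A y) {x : ℂ} (hx : x ∈ cutDisk ρ) :
    ∀ᶠ z in 𝓝[≠] x, AnalyticAt ℂ y z ∧ y z ≠ 0 ∧ 1 / y z = tailLift A ν d 1 (log z) := by
  filter_upwards [(hy.meromorphic x hx).eventually_analyticAt,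
    nhdsWithin_le_nhds ((isOpen_cutDisk ρ).mem_nhds hx)] with z hz hz'
  exact ⟨hz, one_div_eq_tailLift hy hz' hz⟩

theorem continuousAt_tailLift_log (hν : 0 < ν) (hy : IsBranch μ ν d ρ A y) (k : ℕ) {x : ℂ}
    (hx : x ∈ cutDisk ρ) : ContinuousAt (fun z => tailLift A ν d (k + 1) (log z)) x := by
  have h := ((differentiableOn_tailLift hν hy k).differentiableAt
    ((isOpen_logDisk ρ).mem_nhds (log_mem_logDisk hx))).continuousAt
  exact ContinuousAt.comp (f := log) h (continuousAt_clog hx.1)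

/-- Near the pole `1/y` tends to `0` and agrees, off the point, with a function that is continuous
there. -/
theorem tailLift_log_eq_zero_of_pole (hν : 0 < ν) (hy : IsBranch μ ν d ρ A y) {x : ℂ}
    (hx : x ∈ cutDisk ρ) (hpole : meromorphicOrderAt y x < 0) :
    tailLift A ν d 1 (log x) = 0 := by
  have h1 : Tendsto (fun z => 1 / y z) (𝓝[≠] x) (𝓝 0) := by
    simp only [one_div]
    exact tendsto_inv₀_cobounded.comp (tendsto_cobounded_of_meromorphicOrderAt_neg hpole)
  have h2 : Tendsto (fun z => tailLift A ν d 1 (log z)) (𝓝[≠] x) (𝓝 (tailLift A ν d 1 (log x))) :=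
    (continuousAt_tailLift_log hν hy 0 hx).tendsto.mono_left nhdsWithin_le_nhds
  refine tendsto_nhds_unique h2 (h1.congr' ?_)
  filter_upwards [eventually_one_div_eq hy hx] with z hz using hz.2.2
end

/-! ### The differential equation for `U` in the variable `log x`. -/

theorem deriv_one_div_comp_log {y U : ℂ → ℂ} {z : ℂ} (hz : z ∈ slitPlane)
    (hU : AnalyticAt ℂ U (log z)) (hU0 : U (log z) ≠ 0)
    (h : y =ᶠ[𝓝 z] fun w => 1 / U (log w)) :
    deriv y z = -(deriv U (log z) / z) / U (log z) ^ 2 := by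
  rw [h.deriv_eq]
  have h1 : HasDerivAt (fun w => U (log w)) (deriv U (log z) * z⁻¹) z :=
    HasDerivAt.comp z hU.differentiableAt.hasDerivAt (hasDerivAt_log hz)
  have h2 := h1.inv hU0
  simp only [one_div]
  refine h2.deriv.trans ?_
  rw [div_eq_mul_inv (deriv U (log z))]

theorem deriv_deriv_one_div_comp_log {y U : ℂ → ℂ} {z : ℂ} (hz : z ∈ slitPlane)
    (hU : AnalyticAt ℂ U (log z)) (hU0 : U (log z) ≠ 0)
    (h : y =ᶠ[𝓝 z] fun w => 1 / U (log w)) :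
    deriv (deriv y) z = -((deriv (deriv U) (log z) - deriv U (log z)) / z ^ 2) / U (log z) ^ 2
      + 2 * (deriv U (log z) / z) ^ 2 / U (log z) ^ 3 := by
  have hz0 := slitPlane_ne_zero hz
  have hlog : ContinuousAt log z := continuousAt_clog hz
  have e : deriv y =ᶠ[𝓝 z] fun w => -(deriv U (log w) / w) / U (log w) ^ 2 := by
    filter_upwards [h.eventually_nhds, isOpen_slitPlane.mem_nhds hz,
      hlog.eventually hU.eventually_analyticAt,
      (ContinuousAt.comp (f := log) hU.continuousAt hlog).eventually_ne hU0] with w h1 h2 h3 h4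
    exact deriv_one_div_comp_log h2 h3 h4 h1
  rw [e.deriv_eq]
  have h1 : HasDerivAt (fun w => U (log w)) (deriv U (log z) * z⁻¹) z :=
    HasDerivAt.comp z hU.differentiableAt.hasDerivAt (hasDerivAt_log hz)
  have h2 : HasDerivAt (fun w => deriv U (log w)) (deriv (deriv U) (log z) * z⁻¹) z :=
    HasDerivAt.comp z hU.deriv.differentiableAt.hasDerivAt (hasDerivAt_log hz)
  have h3 := ((h2.div (hasDerivAt_id z) hz0).neg).div (h1.pow 2) (pow_ne_zero 2 hU0)
  refine (h3.deriv).trans ?_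
  simp only [id, Pi.neg_apply, Pi.div_apply, Pi.pow_apply]
  field_simp
  ring

section
variable {μ d : ℂ} {ν ρ : ℝ} {A : ℕ → ℤ → ℂ} {y : ℂ → ℂ}

theorem analyticAt_tailLift (hν : 0 < ν) (hy : IsBranch μ ν d ρ A y) (k : ℕ) {s : ℂ}
    (hs : s ∈ logDisk ρ) : AnalyticAt ℂ (tailLift A ν d (k + 1)) s :=
  (differentiableOn_tailLift hν hy k).analyticAt ((isOpen_logDisk ρ).mem_nhds hs)

theorem pviPoly_tailLift_of_regular (hν : 0 < ν) (hy : IsBranch μ ν d ρ A y) {s : ℂ}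
    (hs : s ∈ logDisk ρ) (h1 : Real.exp s.re < 1) (hU1 : tailLift A ν d 1 s ≠ 1)
    (hxU : exp s * tailLift A ν d 1 s ≠ 1) (ha : AnalyticAt ℂ y (exp s)) :
    pviPoly (2 * μ - 1) (exp s) (tailLift A ν d 1 s) (deriv (tailLift A ν d 1) s)
      (deriv (deriv (tailLift A ν d 1)) s) = 0 := by
  have hz : exp s ∈ cutDisk ρ := exp_mem_cutDisk hs.1 hs.2
  have hlog : log (exp s) = s := log_exp_of_abs_lt hs.2
  have hU := analyticAt_tailLift hν hy 0 hs
  have hev : y =ᶠ[𝓝 (exp s)] fun w => 1 / tailLift A ν d 1 (log w) := by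
    filter_upwards [ha.eventually_analyticAt, (isOpen_cutDisk ρ).mem_nhds hz] with w h2 h3
    rw [← (one_div_eq_tailLift hy h3 h2).2, one_div_one_div]
  obtain ⟨hy0, hyU⟩ := one_div_eq_tailLift hy hz ha
  rw [hlog] at hyU
  have hU0 : tailLift A ν d 1 s ≠ 0 := by rw [← hyU]; exact one_div_ne_zero hy0
  have hyU' : y (exp s) = 1 / tailLift A ν d 1 s := by rw [← hyU, one_div_one_div]
  have hx1 : exp s ≠ 1 := by
    intro h
    have := congrArg norm h
    rw [norm_exp, norm_one] at this
    linarith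
  have hd1 := deriv_one_div_comp_log (U := tailLift A ν d 1) hz.1 (by rwa [hlog]) (by rwa [hlog]) hev
  have hd2 := deriv_deriv_one_div_comp_log (U := tailLift A ν d 1) hz.1 (by rwa [hlog])
    (by rwa [hlog]) hev
  rw [hlog] at hd1 hd2
  refine pviPoly_eq_zero_of_pvi (exp_ne_zero s) hx1 hU0 hU1 hxU hyU' hd1 hd2
    (hy.solves _ hz ha hx1 hy0 ?_ ?_)
  · rw [hyU']; intro h; exact hU1 ((div_eq_one_iff_eq hU0).1 h).symm
  · rw [hyU']; intro h; exact hxU ((div_eq_iff hU0).1 h).symm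

/-- The polynomial form is continuous in `s`, so it extends from generic points to the poles of `y`
and to the points where `U = 1`. -/
theorem exists_pviPoly_tailLift_eq_zero (hν : 0 < ν) (hy : IsBranch μ ν d ρ A y) :
    ∃ r : ℝ, 0 < r ∧ r < ρ ∧ ∀ s ∈ logDisk r,
      pviPoly (2 * μ - 1) (exp s) (tailLift A ν d 1 s) (deriv (tailLift A ν d 1) s)
        (deriv (deriv (tailLift A ν d 1)) s) = 0 := by
  have hρ := hy.radius_pos
  obtain ⟨C, hC, hCb⟩ := exists_norm_tailLift_le hν hy 0 (half_pos hρ) (half_lt_self hρ)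
  -- The bounds `1` and `1/C` force `|x| < 1` and `|x U| < 1`, excluding `x = 1` and `y = x`.
  refine ⟨min (ρ / 2) (min 1 (1 / C)), by positivity,
    (min_le_left _ _).trans_lt (half_lt_self hρ), fun s hs => ?_⟩
  have hsub : logDisk (min (ρ / 2) (min 1 (1 / C))) ⊆ logDisk ρ := fun w hw =>
    ⟨hw.1.trans_le ((min_le_left _ _).trans (half_le_self hρ.le)), hw.2⟩
  have hsρ := hsub hs
  have hU := analyticAt_tailLift hν hy 0 hsρ
  rw [zero_add] at hU
  have hU1 : AnalyticAt ℂ (fun w => tailLift A ν d 1 w - 1) s := hU.sub analyticAt_const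
  rcases hU1.eventually_eq_zero_or_eventually_ne_zero with h | h
  -- If `U` is locally `1`, the Painlevé equation says nothing, but the polynomial vanishes at `(1,
  -- 0, 0)` anyway.
  · have e : tailLift A ν d 1 =ᶠ[𝓝 s] fun _ => 1 := h.mono fun w hw => sub_eq_zero.1 hw
    have e1 : deriv (tailLift A ν d 1) =ᶠ[𝓝 s] fun _ => 0 := by
      filter_upwards [e.eventually_nhds] with w hw
      exact (EventuallyEq.deriv_eq (f := fun _ => (1 : ℂ)) hw).trans (deriv_const _ _)
    rw [e.eq_of_nhds, e1.eq_of_nhds, e1.deriv_eq, deriv_const]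
    unfold pviPoly; ring
  · have hcont : ContinuousAt (fun w => pviPoly (2 * μ - 1) (exp w) (tailLift A ν d 1 w)
        (deriv (tailLift A ν d 1) w) (deriv (deriv (tailLift A ν d 1)) w)) s := by
      have h0 := hU.continuousAt
      have h1 := hU.deriv.continuousAt
      have h2 := hU.deriv.deriv.continuousAt
      unfold pviPoly
      fun_prop
    have hexp : Tendsto exp (𝓝[≠] s) (𝓝[≠] (exp s)) :=
      (hasDerivAt_exp s).tendsto_nhdsNE (exp_ne_zero s)
    have hz : exp s ∈ cutDisk ρ := exp_mem_cutDisk hsρ.1 hsρ.2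
    refine tendsto_nhds_unique (l := 𝓝[≠] s) (hcont.tendsto.mono_left nhdsWithin_le_nhds) ?_
    refine tendsto_const_nhds.congr' ?_
    filter_upwards [h, hexp.eventually (eventually_one_div_eq hy hz),
      nhdsWithin_le_nhds ((isOpen_logDisk _).mem_nhds hs)] with w h1 h2 h3
    refine (pviPoly_tailLift_of_regular hν hy (hsub h3) ?_ (sub_ne_zero.1 h1) ?_ h2.1).symm
    · exact h3.1.trans_le ((min_le_right _ _).trans (min_le_left _ _))
    · intro h
      have hb := hCb w (h3.1.le.trans (min_le_left _ _)) h3.2.le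
      have := congrArg norm h
      rw [norm_mul, norm_exp, norm_one] at this
      have h4 : Real.exp w.re < 1 / C := h3.1.trans_le ((min_le_right _ _).trans (min_le_right _ _))
      rw [lt_div_iff₀ hC] at h4
      nlinarith [Real.exp_pos w.re]

end

/-! ### First-order jets, Laurent polynomials, translation by periods. -/

/-- `f k = f₀ + f₁ X k + o(X k)` along a sequence `X`. -/
def IsJet (X f : ℕ → ℂ) (f₀ f₁ : ℂ) : Prop :=
  ∃ r : ℕ → ℂ, Tendsto r atTop (𝓝 f₁) ∧ ∀ k, f k = f₀ + X k * r k

namespace IsJet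
variable {X f g : ℕ → ℂ} {f₀ f₁ g₀ g₁ : ℂ}

theorem const (X : ℕ → ℂ) (c : ℂ) : IsJet X (fun _ => c) c 0 :=
  ⟨fun _ => 0, tendsto_const_nhds, fun _ => by ring⟩

theorem self (X : ℕ → ℂ) : IsJet X X 0 1 := ⟨fun _ => 1, tendsto_const_nhds, fun _ => by ring⟩

theorem add (hf : IsJet X f f₀ f₁) (hg : IsJet X g g₀ g₁) :
    IsJet X (fun k => f k + g k) (f₀ + g₀) (f₁ + g₁) := by
  obtain ⟨r, hr, hf⟩ := hf
  obtain ⟨q, hq, hg⟩ := hg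
  exact ⟨fun k => r k + q k, hr.add hq, fun k => by simp only [hf, hg]; ring⟩

theorem sub (hf : IsJet X f f₀ f₁) (hg : IsJet X g g₀ g₁) :
    IsJet X (fun k => f k - g k) (f₀ - g₀) (f₁ - g₁) := by
  obtain ⟨r, hr, hf⟩ := hf
  obtain ⟨q, hq, hg⟩ := hg
  exact ⟨fun k => r k - q k, hr.sub hq, fun k => by simp only [hf, hg]; ring⟩

theorem mul (hX : Tendsto X atTop (𝓝 0)) (hf : IsJet X f f₀ f₁) (hg : IsJet X g g₀ g₁) :
    IsJet X (fun k => f k * g k) (f₀ * g₀) (f₀ * g₁ + f₁ * g₀) := by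
  obtain ⟨r, hr, hf⟩ := hf
  obtain ⟨q, hq, hg⟩ := hg
  refine ⟨fun k => f₀ * q k + r k * g₀ + X k * (r k * q k), ?_, fun k => by simp only [hf, hg]; ring⟩
  have := ((hq.const_mul f₀).add (hr.mul_const g₀)).add (hX.mul (hr.mul hq))
  simpa using this

theorem eq_zero (hX : Tendsto X atTop (𝓝 0)) (hX0 : ∀ k, X k ≠ 0) (hf : IsJet X f f₀ f₁)
    (h : ∀ k, f k = 0) : f₁ = 0 := by
  obtain ⟨r, hr, hf⟩ := hf
  have h1 : Tendsto (fun k => f₀ + X k * r k) atTop (𝓝 (f₀ + 0 * f₁)) :=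
    (hX.mul hr).const_add f₀
  have h2 : f₀ = 0 := by
    have : (fun k => f₀ + X k * r k) = fun _ => 0 := funext fun k => by rw [← hf, h]
    rw [this] at h1
    simpa using (tendsto_nhds_unique h1 tendsto_const_nhds)
  have h3 : r = fun _ => 0 := funext fun k => by
    have := hf k
    rw [h, h2, zero_add] at this
    exact (mul_eq_zero.1 this.symm).resolve_left (hX0 k)
  rw [h3] at hr
  exact tendsto_nhds_unique hr tendsto_const_nhds

/-- The first-order coefficient splits into the variation in `(u, u₁, u₂)`, which is `linOp`, and
the explicit derivative in `x`, which is `-linRhs`. -/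
theorem pviPoly {u u₁ u₂ : ℕ → ℂ} {p p₁ p₂ v v₁ v₂ : ℂ} (a : ℂ) (hX : Tendsto X atTop (𝓝 0))
    (hu : IsJet X u p v) (hu₁ : IsJet X u₁ p₁ v₁) (hu₂ : IsJet X u₂ p₂ v₂) :
    IsJet X (fun k => _root_.pviPoly a (X k) (u k) (u₁ k) (u₂ k)) (_root_.pviPoly a 0 p p₁ p₂)
      (linOp a p p₁ p₂ v v₁ v₂ - linRhs a p p₁ p₂) := by
  have m {f g : ℕ → ℂ} {f₀ f₁ g₀ g₁ : ℂ} (hf : IsJet X f f₀ f₁) (hg : IsJet X g g₀ g₁) :=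
    hf.mul hX hg
  have c := const X
  have x := self X
  have i1 := (c 1).sub hu
  have i2 := (c 1).sub (m x hu)
  have i3 := (c 1).sub x
  have i4 := m i3 i3
  have t1 := m (m (m (m (m (c 2) hu) i1) i2) i4) hu₂
  have t2 := m (m i4 (m hu₁ hu₁)) (((c 1).sub (m (c 2) hu)).add
    (m x ((m (c 3) (m hu hu)).sub (m (c 2) hu))))
  have t3 := m (m (m (m (m (m (c 2) x) i3) hu) i1) i2) hu₁
  have t4 := m (m (m (m (m (c 2) x) (m hu hu)) i1) i4) hu₁
  have t5 := m (m i1 i1) ((m (c (a ^ 2)) (m i2 i2)).sub (m (m x i3) (m hu hu)))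
  have t := (((t1.sub t2).sub t3).add t4).add t5
  convert t using 1
  · funext k; unfold _root_.pviPoly; ring
  · unfold _root_.pviPoly; ring
  · unfold linOp linRhs; ring
end IsJet

/-- The Laurent polynomial with modes `-2, …, 2` in `exp (l s)`. -/
noncomputable def laurent (l c₂ c₁ c₀ b₁ b₂ s : ℂ) : ℂ :=
  c₂ * exp (l * s) ^ 2 + c₁ * exp (l * s) + c₀ + b₁ * exp (-(l * s)) + b₂ * exp (-(l * s)) ^ 2

theorem hasDerivAt_laurent (l c₂ c₁ c₀ b₁ b₂ s : ℂ) :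
    HasDerivAt (laurent l c₂ c₁ c₀ b₁ b₂)
      (laurent l (2 * l * c₂) (l * c₁) 0 (-(l * b₁)) (-(2 * l * b₂)) s) s := by
  have h1 : HasDerivAt (fun s => exp (l * s)) (exp (l * s) * (l * 1)) s :=
    ((hasDerivAt_id s).const_mul l).cexp
  have h2 : HasDerivAt (fun s => exp (-(l * s))) (exp (-(l * s)) * -(l * 1)) s :=
    ((hasDerivAt_id s).const_mul l).neg.cexp
  have h := (((((h1.pow 2).const_mul c₂).add (h1.const_mul c₁)).add_const c₀).add
    (h2.const_mul b₁)).add ((h2.pow 2).const_mul b₂)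
  refine h.congr_deriv ?_
  unfold laurent
  push_cast
  ring

theorem deriv_laurent (l c₂ c₁ c₀ b₁ b₂ : ℂ) :
    deriv (laurent l c₂ c₁ c₀ b₁ b₂)
      = laurent l (2 * l * c₂) (l * c₁) 0 (-(l * b₁)) (-(2 * l * b₂)) :=
  funext fun s => (hasDerivAt_laurent l c₂ c₁ c₀ b₁ b₂ s).deriv

theorem differentiable_laurent (l c₂ c₁ c₀ b₁ b₂ : ℂ) :
    Differentiable ℂ (laurent l c₂ c₁ c₀ b₁ b₂) := fun s =>
  (hasDerivAt_laurent l c₂ c₁ c₀ b₁ b₂ s).differentiableAt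

theorem yLift_one_eq (A : ℕ → ℤ → ℂ) (ν : ℝ) (d : ℂ) :
    yLift A ν d 1 = laurent (2 * I * ν) 0 (A 1 1 * exp (2 * I * d)) (A 1 0)
      (A 1 (-1) * exp (-(2 * I * d))) 0 := by
  funext s
  have : Finset.Icc (-((1 : ℕ) : ℤ)) (1 : ℕ) = {-1, 0, 1} := by decide
  simp only [yLift, this, mode, laurent]
  rw [Finset.sum_insert (by decide), Finset.sum_insert (by decide), Finset.sum_singleton]
  push_cast
  simp only [mul_zero, zero_mul, exp_zero, mul_one, mul_neg, neg_mul]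
  ring

theorem yLift_two_eq (A : ℕ → ℤ → ℂ) (ν : ℝ) (d : ℂ) :
    yLift A ν d 2 = laurent (2 * I * ν) (A 2 2 * exp (2 * I * d) ^ 2) (A 2 1 * exp (2 * I * d))
      (A 2 0) (A 2 (-1) * exp (-(2 * I * d))) (A 2 (-2) * exp (-(2 * I * d)) ^ 2) := by
  funext s
  have : Finset.Icc (-((2 : ℕ) : ℤ)) (2 : ℕ) = {-2, -1, 0, 1, 2} := by decide
  simp only [yLift, this, mode, laurent]
  rw [Finset.sum_insert (by decide), Finset.sum_insert (by decide), Finset.sum_insert (by decide),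
    Finset.sum_insert (by decide), Finset.sum_singleton]
  push_cast
  simp only [← exp_nat_mul]
  push_cast
  simp only [mul_zero, zero_mul, exp_zero, mul_one, mul_neg, neg_mul]
  ring_nf

theorem exp_mul_sub_period {ν : ℝ} (hν : 0 < ν) (s : ℂ) (k : ℤ) :
    exp (2 * I * ν * (s - k * (Real.pi / ν))) = exp (2 * I * ν * s) := by
  have hν' : (ν : ℂ) ≠ 0 := by exact_mod_cast hν.ne'
  rw [exp_eq_exp_iff_exists_int]
  refine ⟨-k, ?_⟩
  field_simp
  push_cast
  ring

theorem laurent_sub_period {ν : ℝ} (hν : 0 < ν) (c₂ c₁ c₀ b₁ b₂ s : ℂ) (k : ℤ) :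
    laurent (2 * I * ν) c₂ c₁ c₀ b₁ b₂ (s - k * (Real.pi / ν))
      = laurent (2 * I * ν) c₂ c₁ c₀ b₁ b₂ s := by
  unfold laurent
  rw [exp_neg, exp_neg, exp_mul_sub_period hν]

/-- Translating by multiples of the period moves a point to `Re s → -∞`. -/
theorem exists_seq_sub_period {ν r : ℝ} (hν : 0 < ν) (s : ℂ) (hr : 0 < r) :
    ∃ T : ℕ → ℂ, (∀ k, Real.exp ((T k).re + 2) < r) ∧ (∀ k, (T k).im = s.im) ∧
      (∀ k, ∃ j : ℤ, T k = s - j * (Real.pi / ν)) ∧ Tendsto (fun k => exp (T k)) atTop (𝓝 0) := by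
  set S : ℕ → ℂ := fun k => s - (k : ℤ) * (Real.pi / ν) with hS
  have hS' : ∀ k, S k = s - ((k * (Real.pi / ν) : ℝ) : ℂ) := fun k => by simp [hS]
  have hlim : Tendsto (fun k : ℕ => (S k).re) atTop atBot := by
    have : ∀ k, (S k).re = s.re + -(k * (Real.pi / ν)) := fun k => by
      rw [hS', sub_re, ofReal_re, sub_eq_add_neg]
    simp only [this]
    refine tendsto_atBot_add_const_left _ _ (tendsto_neg_atTop_atBot.comp ?_)
    exact Tendsto.atTop_mul_const (by positivity) tendsto_natCast_atTop_atTop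
  have h1 : Tendsto (fun k : ℕ => Real.exp ((S k).re + 2)) atTop (𝓝 0) :=
    Real.tendsto_exp_atBot.comp (tendsto_atBot_add_const_right _ _ hlim)
  obtain ⟨N, hN⟩ := eventually_atTop.1 (h1.eventually (gt_mem_nhds hr))
  refine ⟨fun k => S (k + N), fun k => hN _ (Nat.le_add_left _ _), fun k => ?_,
    fun k => ⟨_, rfl⟩, ?_⟩
  · simp only [hS', sub_im, ofReal_im, sub_zero]
  · rw [tendsto_zero_iff_norm_tendsto_zero]
    simp only [norm_exp]
    exact Real.tendsto_exp_atBot.comp (hlim.comp (tendsto_add_atTop_nat N))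

/-- Cauchy's estimate on unit discs; each use costs `1` in `Re s` and in the width of the strip. -/
theorem norm_deriv_le_of_strip {f : ℂ → ℂ} {ρ r b C : ℝ} (hf : DifferentiableOn ℂ f (logDisk ρ))
    (hrρ : r < ρ) (hb : b < Real.pi)
    (h : ∀ s : ℂ, Real.exp s.re ≤ r → |s.im| ≤ b → ‖f s‖ ≤ C) {s : ℂ}
    (h1 : Real.exp (s.re + 1) ≤ r) (h2 : |s.im| ≤ b - 1) : ‖deriv f s‖ ≤ C := by
  have hball : ∀ z ∈ Metric.closedBall s 1, Real.exp z.re ≤ r ∧ |z.im| ≤ b := by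
    intro z hz
    rw [Metric.mem_closedBall, dist_eq_norm] at hz
    have h3 := abs_le.1 ((abs_re_le_norm (z - s)).trans hz)
    have h4 := abs_le.1 ((abs_im_le_norm (z - s)).trans hz)
    rw [sub_re] at h3
    rw [sub_im] at h4
    have h5 := abs_le.1 h2
    refine ⟨(Real.exp_le_exp.2 (by linarith)).trans h1, abs_le.2 ⟨by linarith, by linarith⟩⟩
  have hsub : Metric.closedBall s 1 ⊆ logDisk ρ := fun z hz =>
    ⟨(hball z hz).1.trans_lt hrρ, (hball z hz).2.trans_lt hb⟩
  have := norm_deriv_le_of_forall_mem_sphere_norm_le (R := 1) (C := C) (c := s) (f := f) one_pos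
    ((hf.mono (by rw [closure_ball _ one_ne_zero]; exact hsub)).diffContOnCl)
    fun z hz => h z (hball z (Metric.sphere_subset_closedBall hz)).1
      (hball z (Metric.sphere_subset_closedBall hz)).2
  simpa using this

theorem isJet_add_mul {X w : ℕ → ℂ} {C : ℝ} (hX : Tendsto X atTop (𝓝 0)) (p v : ℂ)
    (hw : ∀ k, ‖w k‖ ≤ C) : IsJet X (fun k => p + X k * (v + X k * w k)) p v := by
  refine ⟨fun k => v + X k * w k, ?_, fun _ => rfl⟩
  have h : Tendsto (fun k => X k * w k) atTop (𝓝 0) := by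
    refine squeeze_zero_norm (a := fun k => ‖X k‖ * C) (fun k => ?_) ?_
    · rw [norm_mul]; gcongr; exact hw k
    · simpa using hX.norm.mul_const C
  simpa using h.const_add v

/-! ### The linear equation satisfied by `y₂`. -/

section
variable {μ d : ℂ} {ν ρ : ℝ} {A : ℕ → ℤ → ℂ} {y : ℂ → ℂ}

theorem tailLift_one_eq (hν : 0 < ν) (hy : IsBranch μ ν d ρ A y) {s : ℂ} (hs : s ∈ logDisk ρ) :
    tailLift A ν d 1 s = yLift A ν d 1 s + exp s * (yLift A ν d 2 s + exp s * tailLift A ν d 3 s) := by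
  rw [tailLift_eq hν hy 0 hs, tailLift_eq hν hy 1 hs]

theorem deriv_tailLift_one (hν : 0 < ν) (hy : IsBranch μ ν d ρ A y) {s : ℂ} (hs : s ∈ logDisk ρ) :
    deriv (tailLift A ν d 1) s = deriv (yLift A ν d 1) s
      + exp s * ((yLift A ν d 2 s + deriv (yLift A ν d 2) s)
        + exp s * (2 * tailLift A ν d 3 s + deriv (tailLift A ν d 3) s)) := by
  have e : tailLift A ν d 1 =ᶠ[𝓝 s] fun s =>
      yLift A ν d 1 s + exp s * (yLift A ν d 2 s + exp s * tailLift A ν d 3 s) := by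
    filter_upwards [(isOpen_logDisk ρ).mem_nhds hs] with w hw using tailLift_one_eq hν hy hw
  have h1 := (differentiable_yLift A ν d 1 s).hasDerivAt
  have h2 := (differentiable_yLift A ν d 2 s).hasDerivAt
  have h3 := (analyticAt_tailLift hν hy 2 hs).differentiableAt.hasDerivAt
  have he := hasDerivAt_exp s
  rw [e.deriv_eq]
  refine (h1.add (he.mul (h2.add (he.mul h3)))).deriv.trans ?_
  simp only [Pi.add_apply, Pi.mul_apply]
  ring

theorem deriv_deriv_tailLift_one (hν : 0 < ν) (hy : IsBranch μ ν d ρ A y) {s : ℂ}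
    (hs : s ∈ logDisk ρ) :
    deriv (deriv (tailLift A ν d 1)) s = deriv (deriv (yLift A ν d 1)) s
      + exp s * ((yLift A ν d 2 s + 2 * deriv (yLift A ν d 2) s + deriv (deriv (yLift A ν d 2)) s)
        + exp s * (4 * tailLift A ν d 3 s + 4 * deriv (tailLift A ν d 3) s
          + deriv (deriv (tailLift A ν d 3)) s)) := by
  have e : deriv (tailLift A ν d 1) =ᶠ[𝓝 s] fun s => deriv (yLift A ν d 1) s
      + exp s * ((yLift A ν d 2 s + deriv (yLift A ν d 2) s)
        + exp s * (2 * tailLift A ν d 3 s + deriv (tailLift A ν d 3) s)) := by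
    filter_upwards [(isOpen_logDisk ρ).mem_nhds hs] with w hw using deriv_tailLift_one hν hy hw
  have a1 := (differentiable_yLift A ν d 1).analyticAt s
  have a2 := (differentiable_yLift A ν d 2).analyticAt s
  have a3 := analyticAt_tailLift hν hy 2 hs
  have h1 := a1.deriv.differentiableAt.hasDerivAt
  have h2 := a2.differentiableAt.hasDerivAt
  have h2' := a2.deriv.differentiableAt.hasDerivAt
  have h3 := a3.differentiableAt.hasDerivAt
  have h3' := a3.deriv.differentiableAt.hasDerivAt
  have he := hasDerivAt_exp s
  rw [e.deriv_eq]
  refine (h1.add (he.mul ((h2.add h2').add (he.mul ((h3.const_mul 2).add h3'))))).deriv.trans ?_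
  simp only [Pi.add_apply, Pi.mul_apply]
  ring

/-- The equation for `y₂`: the first-order part of the Painlevé equation as `x → 0`. -/
theorem linOp_yLift_eq (hν : 0 < ν) (hy : IsBranch μ ν d ρ A y) {s : ℂ} (hs : |s.im| ≤ 1) :
    linOp (2 * μ - 1) (yLift A ν d 1 s) (deriv (yLift A ν d 1) s)
      (deriv (deriv (yLift A ν d 1)) s) (yLift A ν d 2 s)
      (yLift A ν d 2 s + deriv (yLift A ν d 2) s)
      (yLift A ν d 2 s + 2 * deriv (yLift A ν d 2) s + deriv (deriv (yLift A ν d 2)) s)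
    = linRhs (2 * μ - 1) (yLift A ν d 1 s) (deriv (yLift A ν d 1) s)
      (deriv (deriv (yLift A ν d 1)) s) := by
  obtain ⟨r, hr, hrρ, hE⟩ := exists_pviPoly_tailLift_eq_zero hν hy
  obtain ⟨C, hC, hCb⟩ := exists_norm_tailLift_le hν hy 2 hr hrρ
  -- Two Cauchy estimates shrink the strip from `3` to `2` to `1`, whence the restriction on `Im s`.
  have hpi := Real.pi_gt_three
  have hd0 := differentiableOn_tailLift hν hy 2
  have b0 : ∀ s : ℂ, Real.exp s.re ≤ r → |s.im| ≤ 3 → ‖tailLift A ν d 3 s‖ ≤ C :=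
    fun s h1 h2 => hCb s h1 (h2.trans hpi.le)
  have b1 : ∀ s : ℂ, Real.exp (s.re + 1) ≤ r → |s.im| ≤ 2 → ‖deriv (tailLift A ν d 3) s‖ ≤ C :=
    fun s h1 h2 => norm_deriv_le_of_strip hd0 hrρ hpi b0 h1 (h2.trans (by norm_num))
  have b1' : ∀ s : ℂ, Real.exp s.re ≤ r * Real.exp (-1) → |s.im| ≤ 2 →
      ‖deriv (tailLift A ν d 3) s‖ ≤ C := fun s h1 h2 => b1 s (by
        rw [Real.exp_add]
        calc _ ≤ r * Real.exp (-1) * Real.exp 1 := by gcongr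
          _ = r := by rw [mul_assoc, ← Real.exp_add]; simp) h2
  have hr1 : r * Real.exp (-1) < ρ := by
    have : Real.exp (-1) < 1 := Real.exp_zero ▸ Real.exp_lt_exp.2 (by norm_num)
    nlinarith
  have b2 : ∀ s : ℂ, Real.exp (s.re + 1) ≤ r * Real.exp (-1) → |s.im| ≤ 1 →
      ‖deriv (deriv (tailLift A ν d 3)) s‖ ≤ C := fun s h1 h2 =>
    norm_deriv_le_of_strip (hd0.deriv (isOpen_logDisk ρ)) hr1 (by linarith) b1' h1
      (h2.trans (by norm_num))
  -- Along `T k` the functions `y₁`, `y₂` and their derivatives keep their values at `s` while `x =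
  -- e^{T k}` tends to `0`, so the expansion of `U` becomes a jet in `x` with constant coefficients.
  obtain ⟨T, hTr, hTi, hTs, hX⟩ := exists_seq_sub_period hν s hr
  have hTim : ∀ k, |(T k).im| ≤ 1 := fun k => by rw [hTi]; exact hs
  have hTr0 : ∀ k, Real.exp (T k).re < r := fun k =>
    (Real.exp_lt_exp.2 (by linarith)).trans (hTr k)
  have hTmem : ∀ k, T k ∈ logDisk r := fun k => ⟨hTr0 k, (hTim k).trans_lt (by linarith)⟩
  have hTmem' : ∀ k, T k ∈ logDisk ρ := fun k => ⟨(hTmem k).1.trans hrρ, (hTmem k).2⟩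
  have w0 : ∀ k, ‖tailLift A ν d 3 (T k)‖ ≤ C := fun k =>
    b0 _ (hTr0 k).le ((hTim k).trans (by norm_num))
  have w1 : ∀ k, ‖deriv (tailLift A ν d 3) (T k)‖ ≤ C := fun k =>
    b1 _ ((Real.exp_le_exp.2 (by linarith)).trans (hTr k).le) ((hTim k).trans (by norm_num))
  have w2 : ∀ k, ‖deriv (deriv (tailLift A ν d 3)) (T k)‖ ≤ C := fun k =>
    b2 _ (by
      have := (hTr k).le
      calc Real.exp ((T k).re + 1) = Real.exp ((T k).re + 2) * Real.exp (-1) := by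
            rw [← Real.exp_add]; ring_nf
        _ ≤ _ := by gcongr) (hTim k)
  have per : ∀ c₂ c₁ c₀ b₁ b₂ k, laurent (2 * I * ν) c₂ c₁ c₀ b₁ b₂ (T k)
      = laurent (2 * I * ν) c₂ c₁ c₀ b₁ b₂ s := fun c₂ c₁ c₀ b₁ b₂ k => by
    obtain ⟨j, hj⟩ := hTs k
    rw [hj, laurent_sub_period hν]
  have j0 : IsJet (fun k => exp (T k)) (fun k => tailLift A ν d 1 (T k)) (yLift A ν d 1 s)
      (yLift A ν d 2 s) := by
    have := isJet_add_mul hX (yLift A ν d 1 s) (yLift A ν d 2 s) w0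
    convert this using 2 with k
    rw [tailLift_one_eq hν hy (hTmem' k)]
    simp only [yLift_one_eq, yLift_two_eq, per]
  have j1 : IsJet (fun k => exp (T k)) (fun k => deriv (tailLift A ν d 1) (T k))
      (deriv (yLift A ν d 1) s) (yLift A ν d 2 s + deriv (yLift A ν d 2) s) := by
    have := isJet_add_mul hX (deriv (yLift A ν d 1) s) (yLift A ν d 2 s + deriv (yLift A ν d 2) s)
      (w := fun k => 2 * tailLift A ν d 3 (T k) + deriv (tailLift A ν d 3) (T k))
      (C := 2 * C + C) (fun k => by
        refine (norm_add_le _ _).trans ?_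
        rw [norm_mul, Complex.norm_two]
        linarith [w0 k, w1 k])
    convert this using 2 with k
    rw [deriv_tailLift_one hν hy (hTmem' k)]
    simp only [yLift_one_eq, yLift_two_eq, deriv_laurent, per]
  have j2 : IsJet (fun k => exp (T k)) (fun k => deriv (deriv (tailLift A ν d 1)) (T k))
      (deriv (deriv (yLift A ν d 1)) s)
      (yLift A ν d 2 s + 2 * deriv (yLift A ν d 2) s + deriv (deriv (yLift A ν d 2)) s) := by
    have := isJet_add_mul hX (deriv (deriv (yLift A ν d 1)) s)
      (yLift A ν d 2 s + 2 * deriv (yLift A ν d 2) s + deriv (deriv (yLift A ν d 2)) s)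
      (w := fun k => 4 * tailLift A ν d 3 (T k) + 4 * deriv (tailLift A ν d 3) (T k)
        + deriv (deriv (tailLift A ν d 3)) (T k))
      (C := 4 * C + 4 * C + C) (fun k => by
        refine (norm_add₃_le).trans ?_
        rw [norm_mul, norm_mul, Complex.norm_ofNat]
        linarith [w0 k, w1 k, w2 k])
    convert this using 2 with k
    rw [deriv_deriv_tailLift_one hν hy (hTmem' k)]
    simp only [yLift_one_eq, yLift_two_eq, deriv_laurent, per]
  have := (IsJet.pviPoly (2 * μ - 1) hX j0 j1 j2).eq_zero hX (fun k => exp_ne_zero _)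
    fun k => hE _ (hTmem k)
  exact sub_eq_zero.1 this
end

/-! ### Differential relations for `y₁` and the solution for `y₂`. -/

theorem two_I_mul_ne {ν : ℝ} (hν : 0 < ν) : (2 * I * ν : ℂ) ≠ 0 := by
  have hν' : (ν : ℂ) ≠ 0 := by exact_mod_cast hν.ne'
  simp [hν']

theorem two_I_mul_sq (ν : ℝ) : (2 * I * ν : ℂ) ^ 2 = -4 * ν ^ 2 := by
  rw [mul_pow, mul_pow, I_sq]; ring

theorem one_add_mul_two_I_ne_zero (ν : ℝ) (m : ℤ) : 1 + (m : ℂ) * (2 * I * ν) ≠ 0 := by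
  intro h
  have := congrArg re h
  have e : 1 + (m : ℂ) * (2 * I * ν) = 1 + ((2 * m * ν : ℝ) : ℂ) * I := by push_cast; ring
  rw [e, add_re, re_ofReal_mul] at this
  simp at this

section
variable {μ d : ℂ} {ν ρ : ℝ} {A : ℕ → ℤ → ℂ} {y : ℂ → ℂ}

/-- The first integral of the limiting equation at `x = 0`, checked on the explicit coefficients. It
forces `y₁' = ±(2μ - 1)` at every zero. -/
theorem deriv_yLift_one_sq (hν : 0 < ν) (hy : IsBranch μ ν d ρ A y) (s : ℂ) :
    deriv (yLift A ν d 1) s ^ 2 = (1 - yLift A ν d 1 s)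
      * ((2 * μ - 1) ^ 2 - (2 * I * ν) ^ 2 * yLift A ν d 1 s) := by
  have hν' : (ν : ℂ) ≠ 0 := by exact_mod_cast hν.ne'
  rw [yLift_one_eq, deriv_laurent, hy.coeff_neg_one, hy.coeff_zero, hy.coeff_one]
  unfold laurent
  rw [exp_neg, exp_neg]
  have hE := exp_ne_zero (2 * I * ν * s)
  have hD := exp_ne_zero (2 * I * d)
  generalize exp (2 * I * ν * s) = E at *
  generalize exp (2 * I * d) = D at *
  field_simp
  ring_nf
  simp only [I_sq, I_pow_three, I_pow_four, show (I : ℂ) ^ 5 = I by rw [pow_succ, I_pow_four, one_mul],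
    show (I : ℂ) ^ 6 = -1 by rw [pow_add I 4 2, I_pow_four, I_sq, one_mul]]
  ring

theorem deriv_deriv_yLift_one (hν : 0 < ν) (hy : IsBranch μ ν d ρ A y) (s : ℂ) :
    deriv (deriv (yLift A ν d 1)) s = -((2 * μ - 1) ^ 2 + (2 * I * ν) ^ 2) / 2
      + (2 * I * ν) ^ 2 * yLift A ν d 1 s := by
  have hν' : (ν : ℂ) ≠ 0 := by exact_mod_cast hν.ne'
  rw [yLift_one_eq, deriv_laurent, deriv_laurent, hy.coeff_zero, two_I_mul_sq]
  generalize hl : (2 * I * ν : ℂ) = l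
  have hl2 : l ^ 2 = -4 * ν ^ 2 := by rw [← hl, two_I_mul_sq]
  unfold laurent
  have e1 : l * (l * (A 1 1 * exp (2 * I * d))) = l ^ 2 * (A 1 1 * exp (2 * I * d)) := by ring
  have e2 : -(l * -(l * (A 1 (-1) * exp (-(2 * I * d))))) = l ^ 2 * (A 1 (-1) * exp (-(2 * I * d))) := by
    ring
  rw [e1, e2, hl2]
  field_simp
  ring

theorem deriv_deriv_deriv_yLift_one (hν : 0 < ν) (hy : IsBranch μ ν d ρ A y) (s : ℂ) :
    deriv (deriv (deriv (yLift A ν d 1))) s = (2 * I * ν) ^ 2 * deriv (yLift A ν d 1) s := by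
  have : deriv (deriv (yLift A ν d 1)) = fun s => -((2 * μ - 1) ^ 2 + (2 * I * ν) ^ 2) / 2
      + (2 * I * ν) ^ 2 * yLift A ν d 1 s := funext (deriv_deriv_yLift_one hν hy)
  rw [this]
  exact (((differentiable_yLift A ν d 1 s).hasDerivAt.const_mul _).const_add _).deriv

/-- Both sides are entire, so the identity theorem removes the restriction on `Im s`. -/
theorem linOp_yLift_eq_of_any (hν : 0 < ν) (hy : IsBranch μ ν d ρ A y) (s : ℂ) :
    linOp (2 * μ - 1) (yLift A ν d 1 s) (deriv (yLift A ν d 1) s)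
      (deriv (deriv (yLift A ν d 1)) s) (yLift A ν d 2 s)
      (yLift A ν d 2 s + deriv (yLift A ν d 2) s)
      (yLift A ν d 2 s + 2 * deriv (yLift A ν d 2) s + deriv (deriv (yLift A ν d 2)) s)
    = linRhs (2 * μ - 1) (yLift A ν d 1 s) (deriv (yLift A ν d 1) s)
      (deriv (deriv (yLift A ν d 1)) s) := by
  have hd : ∀ k ∈ ({1, 2} : Set ℕ), Differentiable ℂ (yLift A ν d k) ∧
      Differentiable ℂ (deriv (yLift A ν d k)) ∧
      Differentiable ℂ (deriv (deriv (yLift A ν d k))) := by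
    rintro k (rfl | rfl)
    · rw [yLift_one_eq, deriv_laurent, deriv_laurent]
      exact ⟨differentiable_laurent _ _ _ _ _ _, differentiable_laurent _ _ _ _ _ _,
        differentiable_laurent _ _ _ _ _ _⟩
    · rw [yLift_two_eq, deriv_laurent, deriv_laurent]
      exact ⟨differentiable_laurent _ _ _ _ _ _, differentiable_laurent _ _ _ _ _ _,
        differentiable_laurent _ _ _ _ _ _⟩
  obtain ⟨p0, p1, p2⟩ := hd 1 (by simp)
  obtain ⟨v0, v1, v2⟩ := hd 2 (by simp)
  have hl : AnalyticOnNhd ℂ (fun s => linOp (2 * μ - 1) (yLift A ν d 1 s) (deriv (yLift A ν d 1) s)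
      (deriv (deriv (yLift A ν d 1)) s) (yLift A ν d 2 s)
      (yLift A ν d 2 s + deriv (yLift A ν d 2) s)
      (yLift A ν d 2 s + 2 * deriv (yLift A ν d 2) s + deriv (deriv (yLift A ν d 2)) s)) Set.univ := by
    rw [analyticOnNhd_univ_iff_differentiable]
    unfold linOp
    fun_prop
  have hr : AnalyticOnNhd ℂ (fun s => linRhs (2 * μ - 1) (yLift A ν d 1 s)
      (deriv (yLift A ν d 1) s) (deriv (deriv (yLift A ν d 1)) s)) Set.univ := by
    rw [analyticOnNhd_univ_iff_differentiable]
    unfold linRhs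
    fun_prop
  refine congrFun (hl.eq_of_eventuallyEq hr (z₀ := 0) ?_) s
  have : {s : ℂ | |s.im| < 1} ∈ 𝓝 (0 : ℂ) :=
    (isOpen_lt continuous_im.abs continuous_const).mem_nhds (by simp)
  filter_upwards [this] with w hw
  exact linOp_yLift_eq hν hy (le_of_lt hw)

theorem yLift_one_coeff_ne_zero (hν : 0 < ν) (hy : IsBranch μ ν d ρ A y) :
    A 1 1 * exp (2 * I * d) ≠ 0 ∨ A 1 (-1) * exp (-(2 * I * d)) ≠ 0 := by
  have hν' : (ν : ℂ) ≠ 0 := by exact_mod_cast hν.ne'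
  by_contra! h
  obtain ⟨h1, h2⟩ := h
  rw [hy.coeff_one] at h1
  rw [hy.coeff_neg_one] at h2
  simp only [mul_eq_zero, exp_ne_zero, or_false, div_eq_zero_iff, pow_eq_zero_iff, ne_eq,
    OfNat.ofNat_ne_zero, not_false_eq_true, hν'] at h1 h2
  have : (4 * I * ν : ℂ) = 0 := by linear_combination h2 - h1
  simp [hν'] at this

/-- The explicit form of `y₂`. -/
theorem yLift_two_explicit (hν : 0 < ν) (hy : IsBranch μ ν d ρ A y) (s : ℂ) :
    yLift A ν d 2 s
      = (yLift A ν d 1 s * (1 - yLift A ν d 1 s) + deriv (yLift A ν d 1) s) / 2 := by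
  set l : ℂ := 2 * I * ν with hl
  set α := A 1 1 * exp (2 * I * d) with hα
  set β := A 1 (-1) * exp (-(2 * I * d)) with hβ
  set c := A 1 0 with hc
  have hl0 : l ≠ 0 := two_I_mul_ne hν
  have hp : yLift A ν d 1 = laurent l 0 α c β 0 := yLift_one_eq A ν d
  obtain ⟨c₂, c₁, c₀, b₁, b₂, hv⟩ : ∃ c₂ c₁ c₀ b₁ b₂,
    yLift A ν d 2 = laurent l c₂ c₁ c₀ b₁ b₂ := ⟨_, _, _, _, _, yLift_two_eq A ν d⟩
  have inv_exp : ∀ s, exp (-(l * s)) = (exp (l * s))⁻¹ := fun s => exp_neg _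
  -- The unknowns are the five coefficients of `y₂` minus the particular solution `(y₁(1 - y₁) +
  -- y₁')/2`.
  have key := eq_zero_of_linOp (a := 2 * μ - 1) (c := c) (l := l)
    (h₂ := c₂ + α ^ 2 / 2) (h₁ := c₁ - (α - 2 * α * c + l * α) / 2)
    (h₀ := c₀ - (c - c ^ 2 - 2 * α * β) / 2) (g₁ := b₁ - (β - 2 * β * c - l * β) / 2)
    (g₂ := b₂ + β ^ 2 / 2) (yLift_one_coeff_ne_zero hν hy) (one_add_mul_two_I_ne_zero ν) (by
      intro t ht
      obtain ⟨s, hs⟩ : ∃ s, exp (l * s) = t⁻¹ :=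
        ⟨log t⁻¹ / l, by rw [mul_div_cancel₀ _ hl0, exp_log (inv_ne_zero ht)]⟩
      have h1 := linOp_yLift_eq_of_any hν hy s
      have h2 := linOp_particular (deriv_yLift_one_sq hν hy s) (deriv_deriv_yLift_one hν hy s)
      refine Eq.trans ?_ ((linOp_sub _ _ _ _ _ _ _ _ _ _).trans (sub_eq_zero.2 (h1.trans h2.symm)))
      simp only [hp, hv, deriv_laurent]
      unfold laurent
      rw [inv_exp, hs, inv_inv, ← hl]
      congr 1 <;> field_simp <;> ring)
  obtain ⟨k1, k2, k3, k4, k5⟩ := key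
  rw [hp, hv, deriv_laurent, eq_neg_of_add_eq_zero_left k1, sub_eq_zero.1 k2, sub_eq_zero.1 k3,
    sub_eq_zero.1 k4, eq_neg_of_add_eq_zero_left k5]
  unfold laurent
  rw [inv_exp]
  have hE := exp_ne_zero (l * s)
  field_simp
  ring
end

/-! ### Behaviour of `y₁` and `y₂` near the zeros of `y₁`. -/

theorem norm_laurent_le {ν : ℝ} (hν : 0 < ν) (b : ℝ) (c₂ c₁ c₀ b₁ b₂ : ℂ) :
    ∃ M : ℝ, 0 < M ∧ ∀ s : ℂ, |s.im| ≤ b → ‖laurent (2 * I * ν) c₂ c₁ c₀ b₁ b₂ s‖ ≤ M := by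
  refine ⟨‖c₂‖ * Real.exp (2 * ν * b) ^ 2 + ‖c₁‖ * Real.exp (2 * ν * b) + ‖c₀‖
    + ‖b₁‖ * Real.exp (2 * ν * b) + ‖b₂‖ * Real.exp (2 * ν * b) ^ 2 + 1, by positivity,
    fun s hs => ?_⟩
  have hs' := abs_le.1 hs
  have e : 2 * I * ν * s = ((2 * ν : ℝ) : ℂ) * (I * s) := by push_cast; ring
  have h1 : ‖exp (2 * I * ν * s)‖ ≤ Real.exp (2 * ν * b) := by
    rw [norm_exp, e, re_ofReal_mul]
    simp only [mul_re, I_re, I_im, zero_mul, one_mul, zero_sub]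
    gcongr
    linarith
  have h2 : ‖exp (-(2 * I * ν * s))‖ ≤ Real.exp (2 * ν * b) := by
    rw [norm_exp, e, neg_re, re_ofReal_mul]
    simp only [mul_re, I_re, I_im, zero_mul, one_mul, zero_sub]
    apply Real.exp_le_exp.2
    nlinarith
  refine le_trans ?_ (le_add_of_nonneg_right zero_le_one)
  unfold laurent
  refine (norm_add_le _ _).trans (add_le_add ((norm_add_le _ _).trans (add_le_add
    ((norm_add_le _ _).trans (add_le_add ((norm_add_le _ _).trans (add_le_add ?_ ?_)) le_rfl)) ?_)) ?_)
    <;> simp only [norm_mul, norm_pow] <;> gcongr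

theorem norm_sub_le_of_hasDerivAt {f f' : ℂ → ℂ} {s₀ s : ℂ} {B : ℝ}
    (hf : ∀ w, HasDerivAt f (f' w) w) (h : ∀ w ∈ segment ℝ s₀ s, ‖f' w‖ ≤ B) :
    ‖f s - f s₀‖ ≤ B * ‖s - s₀‖ :=
  (convex_segment s₀ s).norm_image_sub_le_of_norm_hasDerivWithin_le
    (fun w _ => (hf w).hasDerivWithinAt) h (left_mem_segment ℝ s₀ s) (right_mem_segment ℝ s₀ s)

theorem abs_im_le_of_mem_segment {s₀ s w : ℂ} {b : ℝ} (h0 : |s₀.im| ≤ b) (h1 : |s.im| ≤ b)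
    (hw : w ∈ segment ℝ s₀ s) : |w.im| ≤ b := by
  have hc : Convex ℝ {z : ℂ | |z.im| ≤ b} := by
    have : {z : ℂ | |z.im| ≤ b} = imLm ⁻¹' Set.Icc (-b) b := by
      ext z; simp [abs_le]
    rw [this]
    exact (convex_Icc _ _).linear_preimage _
  exact hc.segment_subset h0 h1 hw

section
variable {μ d : ℂ} {ν ρ : ℝ} {A : ℕ → ℤ → ℂ} {y : ℂ → ℂ}

theorem yLift_one_sub_period (hν : 0 < ν) (s : ℂ) (k : ℤ) :
    yLift A ν d 1 (s - k * (Real.pi / ν)) = yLift A ν d 1 s := by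
  rw [yLift_one_eq, laurent_sub_period hν]

/-- On the strip `|Im s| ≤ π`, `y₁` is small only near its zeros. -/
theorem exists_zero_near (hν : 0 < ν) {η : ℝ} (hη : 0 < η) :
    ∃ δ : ℝ, 0 < δ ∧ ∀ s : ℂ, |s.im| ≤ Real.pi → ‖yLift A ν d 1 s‖ < δ →
      ∃ s₀, yLift A ν d 1 s₀ = 0 ∧ ‖s - s₀‖ < η := by
  -- One period rectangle of the strip, minus the open `η`-discs about the zeros: `|y₁|` has a
  -- positive minimum there, unless it is empty.
  set K : Set ℂ := (Set.Icc 0 (Real.pi / ν) ×ℂ Set.Icc (-Real.pi) Real.pi) ∩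
    {s | ∀ s₀, yLift A ν d 1 s₀ = 0 → η ≤ ‖s - s₀‖} with hK
  have hKc : IsCompact K := by
    refine (isCompact_Icc.reProdIm isCompact_Icc).inter_right ?_
    simp only [Set.ofPred_forall]
    exact isClosed_iInter fun s₀ => isClosed_iInter fun _ =>
      isClosed_le continuous_const (by fun_prop)
  have hmin : ∃ δ : ℝ, 0 < δ ∧ ∀ s ∈ K, δ ≤ ‖yLift A ν d 1 s‖ := by
    rcases K.eq_empty_or_nonempty with h | h
    · exact ⟨1, one_pos, by simp [h]⟩
    · obtain ⟨s₁, hs₁, hmin⟩ := hKc.exists_isMinOn h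
        (differentiable_yLift A ν d 1).continuous.norm.continuousOn
      refine ⟨_, norm_pos_iff.2 fun h0 => ?_, hmin⟩
      have := hs₁.2 s₁ h0
      rw [sub_self, norm_zero] at this
      linarith
  obtain ⟨δ, hδ, hδK⟩ := hmin
  refine ⟨δ, hδ, fun s hs hsδ => ?_⟩
  have hT : 0 < Real.pi / ν := by positivity
  set k : ℤ := ⌊s.re / (Real.pi / ν)⌋
  have hs' : (s - k * (Real.pi / ν)) = s - ((k * (Real.pi / ν) : ℝ) : ℂ) := by push_cast; ring
  have h1 : (k : ℝ) * (Real.pi / ν) ≤ s.re := (le_div_iff₀ hT).1 (Int.floor_le _)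
  have h2 : s.re ≤ (k + 1) * (Real.pi / ν) := ((div_lt_iff₀ hT).1 (Int.lt_floor_add_one _)).le
  by_contra! hcon
  have hmem : s - k * (Real.pi / ν) ∈ K := by
    refine ⟨?_, fun s₀ h0 => ?_⟩
    · rw [hs', mem_reProdIm, sub_re, sub_im, ofReal_re, ofReal_im, sub_zero]
      exact ⟨⟨by linarith, by linarith⟩, abs_le.1 hs⟩
    · have := hcon (s₀ + k * (Real.pi / ν)) (by
        rw [← yLift_one_sub_period hν _ k, add_sub_cancel_right, h0])
      rwa [sub_add_eq_sub_sub_swap] at this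
  have := hδK _ hmem
  rw [yLift_one_sub_period hν] at this
  linarith

theorem deriv_yLift_one_sq_of_zero (hν : 0 < ν) (hy : IsBranch μ ν d ρ A y) {s₀ : ℂ}
    (h0 : yLift A ν d 1 s₀ = 0) : deriv (yLift A ν d 1) s₀ ^ 2 = (2 * μ - 1) ^ 2 := by
  rw [deriv_yLift_one_sq hν hy, h0]; ring

theorem norm_deriv_yLift_one_of_zero (hν : 0 < ν) (hy : IsBranch μ ν d ρ A y) {s₀ : ℂ}
    (h0 : yLift A ν d 1 s₀ = 0) : ‖deriv (yLift A ν d 1) s₀‖ = ‖2 * μ - 1‖ := by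
  rcases sq_eq_sq_iff_eq_or_eq_neg.1 (deriv_yLift_one_sq_of_zero hν hy h0) with h | h
  · rw [h]
  · rw [h, norm_neg]

theorem yLift_two_of_zero (hν : 0 < ν) (hy : IsBranch μ ν d ρ A y) {s₀ : ℂ}
    (h0 : yLift A ν d 1 s₀ = 0) : yLift A ν d 2 s₀ = deriv (yLift A ν d 1) s₀ / 2 := by
  rw [yLift_two_explicit hν hy, h0]; ring

/-- Taylor expansions at the zeros of `y₁`, uniform in the zero. -/
theorem exists_taylor_bound (hν : 0 < ν) (hy : IsBranch μ ν d ρ A y) (b : ℝ) :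
    ∃ M : ℝ, 0 < M ∧ ∀ s₀ s : ℂ, |s₀.im| ≤ b → |s.im| ≤ b → yLift A ν d 1 s₀ = 0 →
      ‖yLift A ν d 1 s - deriv (yLift A ν d 1) s₀ * (s - s₀)‖ ≤ M * ‖s - s₀‖ ^ 2 ∧
      ‖yLift A ν d 1 s - deriv (yLift A ν d 1) s₀ * (s - s₀)
        + ((2 * μ - 1) ^ 2 + (2 * I * ν) ^ 2) / 4 * (s - s₀) ^ 2‖ ≤ M * ‖s - s₀‖ ^ 3 ∧
      ‖yLift A ν d 2 s - deriv (yLift A ν d 1) s₀ / 2‖ ≤ M * ‖s - s₀‖ := by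
  obtain ⟨M₁, hM₁, h₁⟩ : ∃ M : ℝ, 0 < M ∧ ∀ s : ℂ, |s.im| ≤ b →
      ‖deriv (deriv (yLift A ν d 1)) s‖ ≤ M := by
    rw [yLift_one_eq, deriv_laurent, deriv_laurent]; exact norm_laurent_le hν b _ _ _ _ _
  obtain ⟨M₂, hM₂, h₂⟩ : ∃ M : ℝ, 0 < M ∧ ∀ s : ℂ, |s.im| ≤ b →
      ‖deriv (deriv (deriv (yLift A ν d 1))) s‖ ≤ M := by
    rw [yLift_one_eq, deriv_laurent, deriv_laurent, deriv_laurent]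
    exact norm_laurent_le hν b _ _ _ _ _
  obtain ⟨M₃, hM₃, h₃⟩ : ∃ M : ℝ, 0 < M ∧ ∀ s : ℂ, |s.im| ≤ b →
      ‖deriv (yLift A ν d 2) s‖ ≤ M := by
    rw [yLift_two_eq, deriv_laurent]; exact norm_laurent_le hν b _ _ _ _ _
  have d₀ : ∀ w, HasDerivAt (yLift A ν d 1) (deriv (yLift A ν d 1) w) w := fun w =>
    (differentiable_yLift A ν d 1 w).hasDerivAt
  have d₁ : ∀ w, HasDerivAt (deriv (yLift A ν d 1)) (deriv (deriv (yLift A ν d 1)) w) w := fun w =>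
    ((differentiable_yLift A ν d 1).analyticAt w).deriv.differentiableAt.hasDerivAt
  have d₂ : ∀ w, HasDerivAt (deriv (deriv (yLift A ν d 1)))
      (deriv (deriv (deriv (yLift A ν d 1))) w) w := fun w =>
    ((differentiable_yLift A ν d 1).analyticAt w).deriv.deriv.differentiableAt.hasDerivAt
  have dv : ∀ w, HasDerivAt (yLift A ν d 2) (deriv (yLift A ν d 2) w) w := fun w =>
    (differentiable_yLift A ν d 2 w).hasDerivAt
  refine ⟨M₁ + M₂ + M₃, by positivity, fun s₀ s hs₀ hs h0 => ?_⟩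
  set P := deriv (yLift A ν d 1) s₀ with hP
  set q := deriv (deriv (yLift A ν d 1)) s₀ with hq
  -- The quadratic Taylor coefficient does not depend on the zero, because `y₁''` is an affine
  -- function of `y₁`.
  have hq' : ((2 * μ - 1) ^ 2 + (2 * I * ν) ^ 2) / 4 = -(q / 2) := by
    rw [hq, deriv_deriv_yLift_one hν hy, h0]; ring
  have seg {w z : ℂ} (hz : z ∈ segment ℝ s₀ s) (hw : w ∈ segment ℝ s₀ z) : |w.im| ≤ b :=
    abs_im_le_of_mem_segment hs₀ (abs_im_le_of_mem_segment hs₀ hs hz) hw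
  have n0 := norm_nonneg (s - s₀)
  have e1 : ∀ w ∈ segment ℝ s₀ s, ‖deriv (yLift A ν d 1) w - P‖ ≤ M₁ * ‖s - s₀‖ := fun w hw =>
    (norm_sub_le_of_hasDerivAt d₁ fun z hz => h₁ z (seg hw hz)).trans
      (mul_le_mul_of_nonneg_left (norm_sub_le_of_mem_segment hw) hM₁.le)
  have e2 : ∀ w ∈ segment ℝ s₀ s, ‖deriv (deriv (yLift A ν d 1)) w - q‖ ≤ M₂ * ‖s - s₀‖ :=
    fun w hw => (norm_sub_le_of_hasDerivAt d₂ fun z hz => h₂ z (seg hw hz)).trans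
      (mul_le_mul_of_nonneg_left (norm_sub_le_of_mem_segment hw) hM₂.le)
  have e3 : ∀ w ∈ segment ℝ s₀ s, ‖deriv (yLift A ν d 1) w - P - q * (w - s₀)‖
      ≤ M₂ * ‖s - s₀‖ * ‖s - s₀‖ := fun w hw => by
    have := norm_sub_le_of_hasDerivAt (s₀ := s₀) (s := w) (B := M₂ * ‖s - s₀‖)
      (f := fun w => deriv (yLift A ν d 1) w - q * (w - s₀))
      (fun w => (d₁ w).sub (((hasDerivAt_id w).sub_const s₀).const_mul q))
      (fun z hz => by
        simp only [mul_one]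
        exact e2 z ((convex_segment s₀ s).segment_subset (left_mem_segment ℝ s₀ s) hw hz))
    simp only [sub_self, mul_zero, sub_zero] at this
    rw [sub_right_comm]
    exact this.trans (by gcongr; exact norm_sub_le_of_mem_segment hw)
  refine ⟨?_, ?_, ?_⟩
  · have := norm_sub_le_of_hasDerivAt (s₀ := s₀) (s := s) (B := M₁ * ‖s - s₀‖)
      (f := fun w => yLift A ν d 1 w - P * (w - s₀))
      (fun w => (d₀ w).sub (((hasDerivAt_id w).sub_const s₀).const_mul P))
      (fun z hz => by simp only [mul_one]; exact e1 z hz)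
    simp only [sub_self, mul_zero, sub_zero, h0] at this
    refine this.trans ?_
    rw [mul_assoc, ← sq]
    gcongr
    linarith
  · have := norm_sub_le_of_hasDerivAt (s₀ := s₀) (s := s) (B := M₂ * ‖s - s₀‖ * ‖s - s₀‖)
      (f := fun w => yLift A ν d 1 w - P * (w - s₀) - q / 2 * (w - s₀) ^ 2)
      (fun w => ((d₀ w).sub (((hasDerivAt_id w).sub_const s₀).const_mul P)).sub
        ((((hasDerivAt_id w).sub_const s₀).pow 2).const_mul (q / 2)))
      (fun z hz => by
        refine le_trans (le_of_eq ?_) (e3 z hz)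
        congr 1
        simp only [id]
        push_cast
        ring)
    simp only [sub_self, mul_zero, sub_zero, h0, ne_eq, OfNat.ofNat_ne_zero, not_false_eq_true,
      zero_pow] at this
    rw [hq', neg_mul, ← sub_eq_add_neg]
    refine this.trans ?_
    rw [show M₂ * ‖s - s₀‖ * ‖s - s₀‖ * ‖s - s₀‖ = M₂ * ‖s - s₀‖ ^ 3 by ring]
    gcongr
    linarith
  · have := norm_sub_le_of_hasDerivAt (s₀ := s₀) (s := s) (B := M₃) dv
      (fun z hz => h₃ z (seg (right_mem_segment ℝ s₀ s) hz))
    rw [yLift_two_of_zero hν hy h0] at this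
    refine this.trans ?_
    gcongr
    linarith

/-- `y₂` inherits every bound of the remainder. -/
theorem norm_yLift_two_le (hν : 0 < ν) (hy : IsBranch μ ν d ρ A y) {r C : ℝ} (hr : 0 < r)
    (hrρ : r < ρ) (hC : RemainderBound A ν d r C) {s : ℂ} (hs : |s.im| < Real.pi) :
    ‖yLift A ν d 2 s‖ ≤ C := by
  obtain ⟨T, hTr, hTi, hTs, hX⟩ := exists_seq_sub_period hν s hr
  obtain ⟨C', hC', hb⟩ := exists_norm_tailLift_le hν hy 2 hr hrρ
  have hTr0 : ∀ k, Real.exp (T k).re < r := fun k =>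
    (Real.exp_lt_exp.2 (by linarith)).trans (hTr k)
  have hTπ : ∀ k, |(T k).im| < Real.pi := fun k => by rw [hTi]; exact hs
  have hlim : Tendsto (fun k => yLift A ν d 2 s + exp (T k) * tailLift A ν d 3 (T k)) atTop
      (𝓝 (yLift A ν d 2 s)) := by
    have h : Tendsto (fun k => exp (T k) * tailLift A ν d 3 (T k)) atTop (𝓝 0) := by
      refine squeeze_zero_norm (a := fun k => ‖exp (T k)‖ * C') (fun k => ?_) ?_
      · rw [norm_mul]; gcongr; exact hb _ (hTr0 k).le (hTπ k).le
      · simpa using hX.norm.mul_const C'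
    simpa using h.const_add (yLift A ν d 2 s)
  refine le_of_tendsto hlim.norm (Eventually.of_forall fun k => ?_)
  have hmem := exp_mem_cutDisk ((hTr0 k).trans hrρ) (hTπ k)
  have h1 := hC (exp (T k)) hmem.1 (by rw [norm_exp]; exact (hTr0 k).le)
  rw [remainder_eq hmem.1, log_exp_of_abs_lt (hTπ k),
    tailLift_eq hν hy 1 ⟨(hTr0 k).trans hrρ, hTπ k⟩] at h1
  obtain ⟨j, hj⟩ := hTs k
  have h2 : yLift A ν d 2 (T k) = yLift A ν d 2 s := by
    rw [hj, yLift_two_eq, laurent_sub_period hν]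
  rwa [h2] at h1

/-- By the maximum modulus principle, `sup |f|` exceeds `|y₂|` at a zero of `y₁` strictly. -/
theorem half_norm_lt_of_zero (hν : 0 < ν) (hy : IsBranch μ ν d ρ A y) (hμ : 2 * μ - 1 ≠ 0)
    {r C : ℝ} (hr : 0 < r) (hrρ : r < ρ) (hC : RemainderBound A ν d r C) {s₀ : ℂ}
    (h0 : yLift A ν d 1 s₀ = 0) (hs₀ : |s₀.im| < Real.pi) : ‖2 * μ - 1‖ / 2 < C := by
  -- Otherwise `|y₂|` has a local maximum at `s₀`, so `y₂` is locally constant and `y₂' = y₂'' = 0`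
  -- at `s₀`.
  by_contra! hle
  have hn : ‖yLift A ν d 2 s₀‖ = ‖2 * μ - 1‖ / 2 := by
    rw [yLift_two_of_zero hν hy h0, norm_div, norm_deriv_yLift_one_of_zero hν hy h0,
      Complex.norm_two]
  have hnear : {s : ℂ | |s.im| < Real.pi} ∈ 𝓝 s₀ :=
    (isOpen_lt continuous_im.abs continuous_const).mem_nhds hs₀
  have hmax : IsLocalMax (norm ∘ yLift A ν d 2) s₀ := by
    filter_upwards [hnear] with s hs
    simp only [Function.comp_apply]
    rw [hn]
    exact (norm_yLift_two_le hν hy hr hrρ hC hs).trans hle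
  have hconst := eventually_eq_of_isLocalMax_norm
    (Eventually.of_forall fun z => differentiable_yLift A ν d 2 z) hmax
  have d₀ : ∀ w, HasDerivAt (yLift A ν d 1) (deriv (yLift A ν d 1) w) w := fun w =>
    (differentiable_yLift A ν d 1 w).hasDerivAt
  have d₁ : ∀ w, HasDerivAt (deriv (yLift A ν d 1)) (deriv (deriv (yLift A ν d 1)) w) w := fun w =>
    ((differentiable_yLift A ν d 1).analyticAt w).deriv.differentiableAt.hasDerivAt
  have d₂ : ∀ w, HasDerivAt (deriv (deriv (yLift A ν d 1)))
      (deriv (deriv (deriv (yLift A ν d 1))) w) w := fun w =>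
    ((differentiable_yLift A ν d 1).analyticAt w).deriv.deriv.differentiableAt.hasDerivAt
  have hv1 : deriv (yLift A ν d 2) = fun s => ((1 - 2 * yLift A ν d 1 s) * deriv (yLift A ν d 1) s
      + deriv (deriv (yLift A ν d 1)) s) / 2 := by
    funext s
    rw [funext (yLift_two_explicit hν hy)]
    refine ((((d₀ s).mul ((d₀ s).const_sub 1)).add (d₁ s)).div_const 2).deriv.trans ?_
    ring
  have hc1 : deriv (yLift A ν d 2) =ᶠ[𝓝 s₀] fun _ => 0 := by
    filter_upwards [hconst.eventually_nhds] with w hw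
    exact (EventuallyEq.deriv_eq (f := fun _ => yLift A ν d 2 s₀) hw).trans (deriv_const _ _)
  have hc2 : deriv (deriv (yLift A ν d 2)) s₀ = 0 := by rw [hc1.deriv_eq, deriv_const]
  have hv2 : deriv (deriv (yLift A ν d 2)) s₀ = ((1 - 2 * yLift A ν d 1 s₀)
      * deriv (deriv (yLift A ν d 1)) s₀ - 2 * deriv (yLift A ν d 1) s₀ ^ 2
      + deriv (deriv (deriv (yLift A ν d 1))) s₀) / 2 := by
    rw [hv1]
    refine ((((((d₀ s₀).const_mul 2).const_sub 1).mul (d₁ s₀)).add (d₂ s₀)).div_const 2).deriv.trans ?_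
    ring
  have g1 := hc1.eq_of_nhds
  rw [hv1] at g1
  rw [hv2] at hc2
  simp only [h0, deriv_deriv_deriv_yLift_one hν hy, deriv_deriv_yLift_one hν hy,
    two_I_mul_sq] at g1 hc2
  have hP2 := deriv_yLift_one_sq_of_zero hν hy h0
  set P := deriv (yLift A ν d 1) s₀ with hP
  have hP0 : P ≠ 0 := fun h => hμ (by rw [h] at hP2; simpa using hP2.symm)
  -- The two conditions make `2P` real and yet give `P² = -1`, which is absurd.
  have k1 : 2 * P = -4 * ν ^ 2 - 1 := by
    have : P * (2 * P - (-4 * ν ^ 2 - 1)) = 0 := by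
      linear_combination 2 * g1 - 2 * hc2
    exact sub_eq_zero.1 ((mul_eq_zero.1 this).resolve_left hP0)
  have k2 : P ^ 2 = -1 := by linear_combination (-4 : ℂ) * g1 + k1 + hP2
  have k3 : (4 * ν ^ 2 + 1) ^ 2 = -(4 : ℝ) := by
    have : ((4 * ν ^ 2 + 1 : ℝ) : ℂ) ^ 2 = ((-4 : ℝ) : ℂ) := by
      push_cast
      linear_combination 4 * k2 - (2 * P + (-4 * ν ^ 2 - 1)) * k1
    exact_mod_cast this
  nlinarith [sq_nonneg (4 * ν ^ 2 + 1)]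
end

/-! ### Elementary inequalities. -/

/-- The left side has derivative `κ < 1` at `0`; the quadratic term is harmless. -/
theorem eventually_tan_lt {κ : ℝ} (hκ : κ < 1) (K : ℝ) :
    ∀ᶠ ε in 𝓝[>] (0 : ℝ), κ * Real.tan ε + K * Real.tan ε ^ 2 < ε := by
  have ht : HasDerivAt Real.tan 1 0 := by
    simpa using Real.hasDerivAt_tan (x := 0) (by simp)
  have h : HasDerivAt (fun ε => κ * Real.tan ε + K * Real.tan ε ^ 2) κ 0 := by
    refine ((ht.const_mul κ).add ((ht.pow 2).const_mul K)).congr_deriv ?_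
    simp
  have h1 := (hasDerivAt_iff_tendsto_slope.1 h).mono_left
    (nhdsWithin_mono (0 : ℝ) fun x (hx : 0 < x) => hx.ne')
  filter_upwards [h1.eventually (gt_mem_nhds hκ), self_mem_nhdsWithin] with ε h2 h3
  have h3 : 0 < ε := h3
  rw [slope_def_field] at h2
  simp only [Real.tan_zero, mul_zero, ne_eq, OfNat.ofNat_ne_zero, not_false_eq_true, zero_pow,
    add_zero, sub_zero] at h2
  rwa [div_lt_one h3] at h2

theorem eventually_mul_tan_pow_lt {n : ℕ} (hn : n ≠ 0) (c : ℝ) {X : ℝ} (hX : 0 < X) :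
    ∀ᶠ ε in 𝓝[>] (0 : ℝ), c * Real.tan ε ^ n < X := by
  have h : ContinuousAt (fun ε => c * Real.tan ε ^ n) 0 :=
    ((Real.continuousAt_tan.2 (by simp)).pow n).const_mul c
  have h1 : Tendsto (fun ε => c * Real.tan ε ^ n) (𝓝[>] 0) (𝓝 0) := by
    simpa [hn] using h.tendsto.mono_left (nhdsWithin_le_nhds (s := Set.Ioi 0))
  exact h1.eventually (gt_mem_nhds hX)

/-- For an axis on or beyond the cut, `|sin (arg x)| ≤ π - |arg x| ≤ |arg x - θ|`; points near such
an axis are nearly real. -/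
theorem abs_im_le_norm_mul {x : ℂ} {θ : ℝ} (hx : x ∈ slitPlane) (hθ : Real.pi ≤ |θ|) :
    |x.im| ≤ ‖x‖ * |arg x - θ| := by
  rw [← norm_mul_sin_arg, abs_mul, abs_norm]
  refine mul_le_mul_of_nonneg_left ?_ (norm_nonneg x)
  have h1 := abs_arg_lt_pi hx
  have h2 : |Real.sin (arg x)| = Real.sin (Real.pi - |arg x|) := by
    rw [Real.sin_pi_sub, Real.abs_sin_eq_sin_abs_of_abs_le_pi h1.le]
  rw [h2]
  have h3 : Real.sin (Real.pi - |arg x|) ≤ Real.pi - |arg x| := Real.sin_le (by linarith)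
  have h4 : |θ| - |arg x| ≤ |arg x - θ| := by
    rw [abs_sub_comm]; exact abs_sub_abs_le_abs_sub _ _
  linarith

theorem sq_bound_of_quadratic {c M N X z : ℝ} (hc : 0 < c) (hM : 0 ≤ M) (hN : 0 ≤ N) (hX : 0 ≤ X)
    (h : c * z ^ 2 ≤ M * X * z + N * X ^ 2) : z ≤ ((M + N) / c + 1) * X := by
  by_contra! hlt
  have h1 : 0 ≤ (M + N) / c := by positivity
  have h2 : X ≤ z := by nlinarith
  have h3 : (M + N) * X = c * ((M + N) / c * X) := by field_simp
  have h4 : c * z ^ 2 ≤ (M + N) * X * z := by nlinarith [mul_nonneg hN hX]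
  have h5 : 0 < z := lt_of_le_of_lt (by positivity) hlt
  have h6 : c * z ≤ (M + N) * X := by
    by_contra! h7
    nlinarith
  rw [h3] at h6
  have h7 : z ≤ (M + N) / c * X := le_of_mul_le_mul_left h6 hc
  nlinarith

/-! ### Location of the poles and pole-free sectors. -/

section
variable {μ d : ℂ} {ν ρ : ℝ} {A : ℕ → ℤ → ℂ} {y : ℂ → ℂ}

theorem norm_yLift_one_le_of_pole (hν : 0 < ν) (hy : IsBranch μ ν d ρ A y) {r C : ℝ}
    (hC : RemainderBound A ν d r C) {x : ℂ} (hx : x ∈ cutDisk ρ) (hxr : ‖x‖ ≤ r)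
    (hpole : meromorphicOrderAt y x < 0) : ‖yLift A ν d 1 (log x)‖ ≤ ‖x‖ * C := by
  have h := tailLift_log_eq_zero_of_pole hν hy hx hpole
  rw [tailLift_eq hν hy 0 (log_mem_logDisk hx), exp_log (slitPlane_ne_zero hx.1)] at h
  rw [eq_neg_of_add_eq_zero_left h, norm_neg, norm_mul]
  gcongr
  have := hC x hx.1 hxr
  rwa [remainder_eq hx.1] at this

theorem yLift_eq_of_pole (hν : 0 < ν) (hy : IsBranch μ ν d ρ A y) {x : ℂ} (hx : x ∈ cutDisk ρ)
    (hpole : meromorphicOrderAt y x < 0) :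
    yLift A ν d 1 (log x) + x * (yLift A ν d 2 (log x) + x * tailLift A ν d 3 (log x)) = 0 := by
  have h := tailLift_log_eq_zero_of_pole hν hy hx hpole
  rwa [tailLift_one_eq hν hy (log_mem_logDisk hx), exp_log (slitPlane_ne_zero hx.1)] at h

theorem abs_arg_sub_im_le (x s : ℂ) : |arg x - s.im| ≤ ‖log x - s‖ := by
  have := abs_im_le_norm (log x - s)
  rwa [sub_im, log_im] at this

theorem exists_noPolesOn (hν : 0 < ν) (hy : IsBranch μ ν d ρ A y) {ε : ℝ} (hε : 0 < ε) :
    ∃ R : ℝ, 0 < R ∧ R < ρ ∧ NoPolesOn y (sectorRegion A ν d R ε) := by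
  have hρ := hy.radius_pos
  obtain ⟨C, hC, hCb⟩ := exists_remainderBound hν hy (half_pos hρ) (half_lt_self hρ)
  obtain ⟨δ, hδ, hnear⟩ := exists_zero_near (A := A) (d := d) hν hε
  refine ⟨min (ρ / 2) (δ / (2 * C)), by positivity, (min_le_left _ _).trans_lt (half_lt_self hρ),
    fun x hx hpole => ?_⟩
  obtain ⟨hxs, hxR, hax⟩ := hx
  have hxρ : x ∈ cutDisk ρ :=
    ⟨hxs, hxR.trans_lt ((min_le_left _ _).trans_lt (half_lt_self hρ))⟩
  have h1 := norm_yLift_one_le_of_pole hν hy hCb hxρ (hxR.trans (min_le_left _ _)) hpole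
  have h2 : ‖x‖ * C ≤ δ / 2 := by
    have := hxR.trans (min_le_right _ _)
    calc ‖x‖ * C ≤ δ / (2 * C) * C := by gcongr
      _ = δ / 2 := by field_simp
  obtain ⟨s₀, h0, hs₀⟩ := hnear (log x) (by rw [log_im]; exact abs_arg_le_pi x) (by linarith)
  have h3 := hax _ ⟨s₀, h0, rfl⟩
  linarith [abs_arg_sub_im_le x s₀]

/-- Poles near `0` lie close to the zeros of `y₁` (case `μ ≠ 1/2`). -/
theorem exists_pole_location (hν : 0 < ν) (hy : IsBranch μ ν d ρ A y) (hμ : 2 * μ - 1 ≠ 0) :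
    ∃ X K : ℝ, 0 < X ∧ 0 < K ∧ X < ρ ∧ ∀ x ∈ cutDisk ρ, ‖x‖ ≤ X → meromorphicOrderAt y x < 0 →
      ∃ s₀, yLift A ν d 1 s₀ = 0 ∧ |arg x - s₀.im| ≤ K * ‖x‖ ∧
        |arg x - s₀.im| ≤ |x.im| / 2 + K * ‖x‖ ^ 2 := by
  have hρ := hy.radius_pos
  have ha : 0 < ‖2 * μ - 1‖ := norm_pos_iff.2 hμ
  set a := ‖2 * μ - 1‖
  obtain ⟨C, hC, hCb⟩ := exists_remainderBound hν hy (half_pos hρ) (half_lt_self hρ)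
  obtain ⟨C', hC', hb⟩ := exists_norm_tailLift_le hν hy 2 (half_pos hρ) (half_lt_self hρ)
  obtain ⟨M, hM, hT⟩ := exists_taylor_bound hν hy (Real.pi + 1)
  -- The radius `1` keeps `s₀` in the strip of half-width `π + 1`; `a/(2M)` lets half the linear
  -- term absorb the quadratic Taylor error.
  obtain ⟨δ, hδ, hnear⟩ := exists_zero_near (A := A) (d := d) hν
    (show 0 < min 1 (a / (2 * M)) by positivity)
  set K₁ := 2 * C / a with hK₁
  have hK₁p : 0 < K₁ := by positivity
  refine ⟨min (ρ / 2) (δ / (2 * C)), K₁ + (M * K₁ ^ 2 + M * K₁ + C') / a, by positivity,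
    by positivity, (min_le_left _ _).trans_lt (half_lt_self hρ), fun x hx hxX hpole => ?_⟩
  have hxr := hxX.trans (min_le_left _ _)
  have h1 := norm_yLift_one_le_of_pole hν hy hCb hx hxr hpole
  have h2 : ‖x‖ * C ≤ δ / 2 := by
    have := hxX.trans (min_le_right _ _)
    calc ‖x‖ * C ≤ δ / (2 * C) * C := by gcongr
      _ = δ / 2 := by field_simp
  have harg : |(log x).im| ≤ Real.pi := by rw [log_im]; exact abs_arg_le_pi x
  obtain ⟨s₀, h0, hs₀⟩ := hnear (log x) harg (by linarith)
  have hs1 : ‖log x - s₀‖ < 1 := hs₀.trans_le (min_le_left _ _)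
  have hs2 : ‖log x - s₀‖ < a / (2 * M) := hs₀.trans_le (min_le_right _ _)
  have hs₀im : |s₀.im| ≤ Real.pi + 1 := by
    have h3 := abs_im_le_norm (log x - s₀)
    rw [sub_im] at h3
    have h4 := abs_le.1 (h3.trans hs1.le)
    have h5 := abs_le.1 harg
    exact abs_le.2 ⟨by linarith, by linarith⟩
  obtain ⟨t1, -, t3⟩ := hT s₀ (log x) hs₀im (harg.trans (by linarith)) h0
  have hP : ‖deriv (yLift A ν d 1) s₀‖ = a := norm_deriv_yLift_one_of_zero hν hy h0
  set P := deriv (yLift A ν d 1) s₀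
  set ζ := log x - s₀
  have hζ0 := norm_nonneg ζ
  have hζ : ‖ζ‖ ≤ K₁ * ‖x‖ := by
    have h3 : ‖P * ζ‖ ≤ ‖yLift A ν d 1 (log x)‖ + M * ‖ζ‖ ^ 2 := by
      have := norm_sub_le (yLift A ν d 1 (log x)) (yLift A ν d 1 (log x) - P * ζ)
      rw [sub_sub_cancel] at this
      linarith
    rw [norm_mul, hP] at h3
    have h4 : M * ‖ζ‖ ≤ a / 2 := by
      calc M * ‖ζ‖ ≤ M * (a / (2 * M)) := by gcongr
        _ = a / 2 := by field_simp
    rw [hK₁, div_mul_eq_mul_div, le_div_iff₀ ha]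
    nlinarith
  have hζ2 : ‖ζ + x / 2‖ ≤ (M * K₁ ^ 2 + M * K₁ + C') / a * ‖x‖ ^ 2 := by
    have hw : ‖tailLift A ν d 3 (log x)‖ ≤ C' := hb _ (by
      rwa [log_re, Real.exp_log (norm_pos_iff.2 (slitPlane_ne_zero hx.1))]) harg
    have h3 := yLift_eq_of_pole hν hy hx hpole
    -- Since `y₁ ≈ P ζ` and `y₂ ≈ P/2`, the pole equation reads `P (ζ + x/2) = O(|x|²)`; the slope
    -- `P` cancels, leaving the coefficient `1/2`.
    have h4 : P * (ζ + x / 2) = -((yLift A ν d 1 (log x) - P * ζ)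
        + x * (yLift A ν d 2 (log x) - P / 2) + x ^ 2 * tailLift A ν d 3 (log x)) := by
      linear_combination h3
    have h5 : a * ‖ζ + x / 2‖ ≤ M * ‖ζ‖ ^ 2 + ‖x‖ * (M * ‖ζ‖) + ‖x‖ ^ 2 * C' := by
      rw [← hP, ← norm_mul, h4, norm_neg]
      refine norm_add₃_le.trans ?_
      rw [norm_mul, norm_mul, norm_pow]
      gcongr
    rw [div_mul_eq_mul_div, le_div_iff₀ ha, mul_comm]
    refine h5.trans ?_
    calc M * ‖ζ‖ ^ 2 + ‖x‖ * (M * ‖ζ‖) + ‖x‖ ^ 2 * C'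
        ≤ M * (K₁ * ‖x‖) ^ 2 + ‖x‖ * (M * (K₁ * ‖x‖)) + ‖x‖ ^ 2 * C' := by gcongr
      _ = _ := by ring
  refine ⟨s₀, h0, ?_, ?_⟩
  · refine (abs_arg_sub_im_le x s₀).trans (hζ.trans ?_)
    gcongr
    exact le_add_of_nonneg_right (by positivity)
  · have h3 := abs_im_le_norm (ζ + x / 2)
    have h4 : (ζ + x / 2).im = (arg x - s₀.im) + x.im / 2 := by
      rw [add_im, sub_im, log_im, show x / 2 = x / ((2 : ℝ) : ℂ) by simp, div_ofReal_im]
    rw [h4] at h3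
    have h5 : |arg x - s₀.im| ≤ |arg x - s₀.im + x.im / 2| + |x.im| / 2 := by
      have := abs_sub (arg x - s₀.im + x.im / 2) (x.im / 2)
      rwa [add_sub_cancel_right, abs_div, abs_two] at this
    have h6 : (M * K₁ ^ 2 + M * K₁ + C') / a * ‖x‖ ^ 2
        ≤ (K₁ + (M * K₁ ^ 2 + M * K₁ + C') / a) * ‖x‖ ^ 2 := by
      gcongr
      exact le_add_of_nonneg_left hK₁p.le
    linarith

/-- Poles near `0` lie close to the zeros of `y₁` (case `μ = 1/2`). -/
theorem exists_pole_location_half (hν : 0 < ν) (hy : IsBranch μ ν d ρ A y) (hμ : 2 * μ - 1 = 0) :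
    ∃ X K : ℝ, 0 < X ∧ 0 < K ∧ X < ρ ∧ ∀ x ∈ cutDisk ρ, ‖x‖ ≤ X → meromorphicOrderAt y x < 0 →
      ∃ s₀, yLift A ν d 1 s₀ = 0 ∧ |arg x - s₀.im| ≤ K * ‖x‖ := by
  have hρ := hy.radius_pos
  obtain ⟨C, hC, hCb⟩ := exists_remainderBound hν hy (half_pos hρ) (half_lt_self hρ)
  obtain ⟨C', hC', hb⟩ := exists_norm_tailLift_le hν hy 2 (half_pos hρ) (half_lt_self hρ)
  obtain ⟨M, hM, hT⟩ := exists_taylor_bound hν hy (Real.pi + 1)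
  obtain ⟨δ, hδ, hnear⟩ := exists_zero_near (A := A) (d := d) hν
    (show 0 < min 1 (ν ^ 2 / (2 * M)) by positivity)
  refine ⟨min (ρ / 2) (δ / (2 * C)), (M + C') / (ν ^ 2 / 2) + 1, by positivity,
    by positivity, (min_le_left _ _).trans_lt (half_lt_self hρ), fun x hx hxX hpole => ?_⟩
  have hxr := hxX.trans (min_le_left _ _)
  have h1 := norm_yLift_one_le_of_pole hν hy hCb hx hxr hpole
  have h2 : ‖x‖ * C ≤ δ / 2 := by
    have := hxX.trans (min_le_right _ _)
    calc ‖x‖ * C ≤ δ / (2 * C) * C := by gcongr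
      _ = δ / 2 := by field_simp
  have harg : |(log x).im| ≤ Real.pi := by rw [log_im]; exact abs_arg_le_pi x
  obtain ⟨s₀, h0, hs₀⟩ := hnear (log x) harg (by linarith)
  have hs1 : ‖log x - s₀‖ < 1 := hs₀.trans_le (min_le_left _ _)
  have hs2 : ‖log x - s₀‖ < ν ^ 2 / (2 * M) := hs₀.trans_le (min_le_right _ _)
  have hs₀im : |s₀.im| ≤ Real.pi + 1 := by
    have h3 := abs_im_le_norm (log x - s₀)
    rw [sub_im] at h3
    have h4 := abs_le.1 (h3.trans hs1.le)
    have h5 := abs_le.1 harg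
    exact abs_le.2 ⟨by linarith, by linarith⟩
  obtain ⟨-, t2, t3⟩ := hT s₀ (log x) hs₀im (harg.trans (by linarith)) h0
  have hP : deriv (yLift A ν d 1) s₀ = 0 := by
    rw [← norm_eq_zero, norm_deriv_yLift_one_of_zero hν hy h0, hμ, norm_zero]
  rw [hP, hμ, two_I_mul_sq] at t2
  rw [hP, zero_div, sub_zero] at t3
  refine ⟨s₀, h0, (abs_arg_sub_im_le x s₀).trans ?_⟩
  set ζ := log x - s₀
  have hζ0 := norm_nonneg ζ
  have hw : ‖tailLift A ν d 3 (log x)‖ ≤ C' := hb _ (by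
    rwa [log_re, Real.exp_log (norm_pos_iff.2 (slitPlane_ne_zero hx.1))]) harg
  have h3 := yLift_eq_of_pole hν hy hx hpole
  have h4 : ‖yLift A ν d 1 (log x)‖ ≤ ‖x‖ * (M * ‖ζ‖ + ‖x‖ * C') := by
    rw [eq_neg_of_add_eq_zero_left h3, norm_neg, norm_mul]
    gcongr
    refine (norm_add_le _ _).trans ?_
    rw [norm_mul]
    gcongr
  -- With `2μ - 1 = 0` the zero is double with leading coefficient `ν²`.
  have h5 : ν ^ 2 * ‖ζ‖ ^ 2 ≤ ‖yLift A ν d 1 (log x)‖ + M * ‖ζ‖ ^ 3 := by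
    have e : yLift A ν d 1 (log x) - 0 * ζ + (0 ^ 2 + -4 * (ν : ℂ) ^ 2) / 4 * ζ ^ 2
        = yLift A ν d 1 (log x) - (ν : ℂ) ^ 2 * ζ ^ 2 := by ring
    rw [e] at t2
    have := norm_sub_le (yLift A ν d 1 (log x))
      (yLift A ν d 1 (log x) - (ν : ℂ) ^ 2 * ζ ^ 2)
    rw [sub_sub_cancel, norm_mul, norm_pow, norm_pow, norm_real, Real.norm_eq_abs, sq_abs] at this
    linarith
  have h6 : M * ‖ζ‖ ≤ ν ^ 2 / 2 := by
    calc M * ‖ζ‖ ≤ M * (ν ^ 2 / (2 * M)) := by gcongr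
      _ = ν ^ 2 / 2 := by field_simp
  -- Half of `ν² |ζ|²` absorbs the cubic error, leaving `(ν²/2) |ζ|² ≤ M |x| |ζ| + C' |x|²`.
  refine sq_bound_of_quadratic (by positivity) hM.le hC'.le (norm_nonneg x) ?_
  nlinarith [mul_le_mul_of_nonneg_right h6 (sq_nonneg ‖ζ‖)]

theorem eventually_noPolesOn (hν : 0 < ν) (hy : IsBranch μ ν d ρ A y) (hμ : 2 * μ - 1 ≠ 0)
    {r C : ℝ} (hr : 0 < r) (hrρ : r < ρ) (hC : 0 < C) (hCb : RemainderBound A ν d r C) :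
    ∀ᶠ ε in 𝓝[>] (0 : ℝ), ∀ R : ℝ, 0 < R → R < ‖2 * μ - 1‖ / C * Real.tan ε →
      R < ρ ∧ NoPolesOn y (sectorRegion A ν d R ε) := by
  have ha : 0 < ‖2 * μ - 1‖ := norm_pos_iff.2 hμ
  set a := ‖2 * μ - 1‖
  obtain ⟨X, K, hX, hK, hXρ, hloc⟩ := exists_pole_location hν hy hμ
  obtain ⟨κ, K', hκ0, hκ, hK', hbound⟩ : ∃ κ K' : ℝ, 0 ≤ κ ∧ κ * (a / C) < 1 ∧ 0 ≤ K' ∧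
      ∀ x ∈ cutDisk ρ, ‖x‖ ≤ X → meromorphicOrderAt y x < 0 →
        ∃ s₀, yLift A ν d 1 s₀ = 0 ∧ |arg x - s₀.im| ≤ κ * ‖x‖ + K' * ‖x‖ ^ 2 := by
    -- If `C ≤ a/2`, the maximum principle shows that no zero of `y₁` lies in the open strip. All
    -- axes are then on or beyond the cut, and the linear term disappears (`κ = 0`).
    by_cases hlt : a / 2 < C
    · refine ⟨1 / 2, K, by norm_num, ?_, hK.le, fun x hx hxX hp => ?_⟩
      · rw [← mul_div_assoc, div_lt_one hC]; linarith
      · obtain ⟨s₀, h0, -, h2⟩ := hloc x hx hxX hp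
        refine ⟨s₀, h0, h2.trans ?_⟩
        have := abs_im_le_norm x
        linarith
    · refine ⟨0, K / 2 + K, le_rfl, by simp, by positivity, fun x hx hxX hp => ?_⟩
      obtain ⟨s₀, h0, h1, h2⟩ := hloc x hx hxX hp
      refine ⟨s₀, h0, h2.trans ?_⟩
      have h3 : Real.pi ≤ |s₀.im| := by
        by_contra! h
        exact hlt (half_norm_lt_of_zero hν hy hμ hr hrρ hCb h0 h)
      have h4 := abs_im_le_norm_mul hx.1 h3
      have h5 : ‖x‖ * |arg x - s₀.im| ≤ ‖x‖ * (K * ‖x‖) := by gcongr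
      nlinarith
  filter_upwards [eventually_tan_lt hκ (K' * (a / C) ^ 2),
    eventually_mul_tan_pow_lt one_ne_zero (a / C) hX] with ε h1 h2 R hR hRlt
  rw [pow_one] at h2
  refine ⟨(hRlt.trans h2).trans hXρ, fun x hx hpole => ?_⟩
  obtain ⟨hxs, hxR, hax⟩ := hx
  have hxX : ‖x‖ ≤ X := hxR.trans (hRlt.trans h2).le
  obtain ⟨s₀, h0, h3⟩ := hbound x ⟨hxs, hxX.trans_lt hXρ⟩ hxX hpole
  have h4 := hax _ ⟨s₀, h0, rfl⟩
  have h5 : ‖x‖ ≤ a / C * Real.tan ε := hxR.trans hRlt.le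
  have h6 : κ * ‖x‖ + K' * ‖x‖ ^ 2 ≤ κ * (a / C * Real.tan ε) + K' * (a / C * Real.tan ε) ^ 2 := by
    gcongr
  rw [mul_pow] at h6
  linarith

/-- The deviation is `O(|x|) = O(tan² ε)`, below `ε` whatever the constant `c`. -/
theorem eventually_noPolesOn_half (hν : 0 < ν) (hy : IsBranch μ ν d ρ A y) (hμ : 2 * μ - 1 = 0)
    (c : ℝ) :
    ∀ᶠ ε in 𝓝[>] (0 : ℝ), ∀ R : ℝ, 0 < R → R < c * Real.tan ε ^ 2 →
      R < ρ ∧ NoPolesOn y (sectorRegion A ν d R ε) := by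
  obtain ⟨X, K, hX, hK, hXρ, hloc⟩ := exists_pole_location_half hν hy hμ
  filter_upwards [eventually_tan_lt zero_lt_one (K * c),
    eventually_mul_tan_pow_lt two_ne_zero c hX] with ε h1 h2 R hR hRlt
  refine ⟨(hRlt.trans h2).trans hXρ, fun x hx hpole => ?_⟩
  obtain ⟨hxs, hxR, hax⟩ := hx
  have hxX : ‖x‖ ≤ X := hxR.trans (hRlt.trans h2).le
  obtain ⟨s₀, h0, h3⟩ := hloc x ⟨hxs, hxX.trans_lt hXρ⟩ hxX hpole
  have h4 := hax _ ⟨s₀, h0, rfl⟩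
  have h5 : K * ‖x‖ ≤ K * (c * Real.tan ε ^ 2) := by gcongr; exact hxR.trans hRlt.le
  linarith
end

theorem proposition6 (μ d : ℂ) (ν : ℝ) (hν : 0 < ν) :
    (∀ (ρ : ℝ) (A : ℕ → ℤ → ℂ) (y : ℂ → ℂ), IsBranch μ ν d ρ A y →
      (∀ r : ℝ, 0 < r → r < ρ → ∃ C : ℝ, 0 < C ∧ RemainderBound A ν d r C) ∧
      (∀ ε : ℝ, 0 < ε → ∃ R : ℝ, 0 < R ∧ R < ρ ∧ NoPolesOn y (sectorRegion A ν d R ε))) ∧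
    (μ ≠ 1 / 2 →
      ∃ g : ℝ → ℝ, g =O[𝓝[>] 0] (fun ε => Real.tan ε ^ 2) ∧
        ∀ (ρ : ℝ) (A : ℕ → ℤ → ℂ) (y : ℂ → ℂ), IsBranch μ ν d ρ A y →
        ∀ r C : ℝ, 0 < r → r < ρ → 0 < C → RemainderBound A ν d r C →
          ∀ᶠ ε in 𝓝[>] (0 : ℝ), ∀ R : ℝ, 0 < R →
            R < ‖2 * μ - 1‖ / C * Real.tan ε * (1 + g ε) →
            R < ρ ∧ NoPolesOn y (sectorRegion A ν d R ε)) ∧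
    (μ = 1 / 2 →
      ∃ g : ℝ → ℝ, g =O[𝓝[>] 0] (fun ε => Real.tan ε ^ 3) ∧
        ∀ (ρ : ℝ) (A : ℕ → ℤ → ℂ) (y : ℂ → ℂ), IsBranch μ ν d ρ A y →
        ∀ r C : ℝ, 0 < r → r < ρ → 0 < C → RemainderBound A ν d r C →
          ∀ᶠ ε in 𝓝[>] (0 : ℝ), ∀ R : ℝ, 0 < R →
            R < 2 * ν ^ 2 / C * Real.tan ε ^ 2 * (1 + g ε) →
            R < ρ ∧ NoPolesOn y (sectorRegion A ν d R ε)) := by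
  refine ⟨fun ρ A y hy => ⟨fun r hr hrρ => exists_remainderBound hν hy hr hrρ,
    fun ε hε => exists_noPolesOn hν hy hε⟩, fun hμ => ?_, fun hμ => ?_⟩
  · have hμ' : 2 * μ - 1 ≠ 0 := fun h => hμ (by linear_combination h / 2)
    -- No correction is needed: the strict inequality `κ |a|/C < 1` leaves room for all higher-order
    -- terms.
    refine ⟨fun _ => 0, isBigO_zero _ _, fun ρ A y hy r C hr hrρ hC hCb => ?_⟩
    simpa using eventually_noPolesOn hν hy hμ' hr hrρ hC hCb
  · have hμ' : 2 * μ - 1 = 0 := by rw [hμ]; ring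
    refine ⟨fun _ => 0, isBigO_zero _ _, fun ρ A y hy r C hr hrρ hC hCb => ?_⟩
    simpa using eventually_noPolesOn_half hν hy hμ' (2 * ν ^ 2 / C)
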